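/- Let $\tilde{\mathcal A}$ be the $\mathbb C$-algebra of formal series $\sum_{\nu\ge 0}P_\nu(a)b^\nu$ with $P_\nu\in\mathbb C[a]$, multiplied by means of the relation $ab-ba=b^2$. For $P\in\tilde{\mathcal A}$ homogeneous of degree $k$ in $(a,b)$ and monic in $a$, that is $P=a^k+c_1a^{k-1}b+\dots+c_kb^k$ with $c_i\in\mathbb C$, its Bernstein polynomial is the unique $B_P\in\mathbb C[x]$ of degree at most $k$ with $(-b)^kB_P(-b^{-1}a)=P$. For $\alpha\in\,]0,1]\cap\mathbb Q$ and $N\in\mathbb N$ let $\Xi_\alpha^{(N)}=\bigoplus_{j=0}^N\mathbb C[[s]]\,s^{\alpha-1}(\mathrm{Log}\,s)^j$, a left $\tilde{\mathcal A}$-module where $a$ is multiplication by $s$ and $b$ is integration in $s$ without constant. An $[\alpha]$-primitive theme is a left $\tilde{\mathcal A}$-module isomorphic to $\tilde{\mathcal A}\varphi$ for some $N$ and some $\varphi\in\Xi_\alpha^{(N)}$; the rank of a left $\tilde{\mathcal A}$-module is its rank over $\mathbb C[[b]]\subset\tilde{\mathcal A}$. Let $T=\tilde{\mathcal A}/\tilde{\mathcal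 A}(a-2b)(a-b)$ and let $e$ be a generator of the left $\tilde{\mathcal A}$-module $T$. Let $P,Q,R$ be homogeneous in $(a,b)$ and monic in $a$, of respective degrees $3$, $4$ and $k\ge 0$, and suppose that 1. $(P+cQ)e=0$ in $T$ for some complex number $c\neq 0$; 2. $B_Q$ is divisible neither by $x+1$ nor by $x+2$; 3. $B_R$ is not divisible by $(x+1)(x+2)(x+3)$. Then $T$ is a $[1]$-primitive theme of rank $2$, and the submodule $\tilde{\mathcal A}Re\subset T$ generated by $Re$ is a $[1]$-primitive theme of rank $2$. -/

import Mathlib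

open Polynomial

noncomputable section

namespace ABModule

/-! ### Formal actions of series in `a` and `b`

`ℕ → W` is the space of formal series with coefficients in `W`; `fil W n` consists of the series
whose first `n` coefficients vanish. -/

/-- The series whose coefficients of index `< n` vanish. -/
def fil (W : Type*) [AddCommGroup W] [Module ℂ W] (n : ℕ) : Submodule ℂ (ℕ → W) where
  carrier := {v | ∀ m < n, v m = 0}
  add_mem' := fun {u v} hu hv m hm => by simp [hu m hm, hv m hm]
  zero_mem' := fun m _ => rfl
  smul_mem' := fun c v hv m hm => by simp [hv m hm]

/-- Two operators `a`, `b` on `ℕ → W` with `a b - b a = b²`, where `a` respects the filtration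
and `b` raises it, so that every series `∑ P_ν(a) b^ν` converges. -/
structure Ops (W : Type*) [AddCommGroup W] [Module ℂ W] where
  a : Module.End ℂ (ℕ → W)
  b : Module.End ℂ (ℕ → W)
  comm : a * b = b * a + b * b
  a_fil : ∀ n, ∀ v ∈ fil W n, a v ∈ fil W n
  b_fil : ∀ n, ∀ v ∈ fil W n, b v ∈ fil W (n + 1)

section Action

variable {W : Type*} [AddCommGroup W] [Module ℂ W] (O : Ops W)

/-- The partial sum `∑_{ν < M} P_ν(a) b^ν v`. -/
def partialAct (M : ℕ) (x : ℕ → ℂ[X]) (v : ℕ → W) : ℕ → W :=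
  ∑ ν ∈ Finset.range M, aeval O.a (x ν) ((O.b ^ ν) v)

/-- The action of `∑ P_ν(a) b^ν` (with `x ν = P_ν`): the limit of the partial sums; the terms with
`ν > m` do not contribute to the coefficient of index `m`. -/
def act (x : ℕ → ℂ[X]) (v : ℕ → W) : ℕ → W := fun m => partialAct O (m + 1) x v m

theorem act_apply (x : ℕ → ℂ[X]) (v : ℕ → W) (m : ℕ) :
    act O x v m = ∑ ν ∈ Finset.range (m + 1), aeval O.a (x ν) ((O.b ^ ν) v) m := by
  simp [act, partialAct]

theorem fil_mono {m n : ℕ} (h : m ≤ n) {v : ℕ → W} (hv : v ∈ fil W n) : v ∈ fil W m :=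
  fun i hi => hv i (lt_of_lt_of_le hi h)

theorem eq_of_fil {u v : ℕ → W} (h : ∀ n, u - v ∈ fil W n) : u = v := by
  funext m
  have := h (m + 1) m (Nat.lt_succ_self m)
  exact sub_eq_zero.1 this

theorem aeval_fil (P : ℂ[X]) {n : ℕ} {v : ℕ → W} (hv : v ∈ fil W n) :
    aeval O.a P v ∈ fil W n := by
  induction P using Polynomial.induction_on' with
  | add p q hp hq => simpa using (fil W n).add_mem hp hq
  | monomial k c =>
    have : ∀ k, (O.a ^ k) v ∈ fil W n := by
      intro k
      induction k with
      | zero => simpa using hv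
      | succ k ih => rw [pow_succ']; exact O.a_fil n _ ih
    rw [aeval_monomial]
    simpa using (fil W n).smul_mem c (this k)

theorem b_pow_fil (k : ℕ) {n : ℕ} {v : ℕ → W} (hv : v ∈ fil W n) :
    (O.b ^ k) v ∈ fil W (n + k) := by
  induction k with
  | zero => simpa using hv
  | succ k ih => rw [pow_succ']; exact O.b_fil _ _ ih

theorem partialAct_sub_mem {M N : ℕ} (h : M ≤ N) (x : ℕ → ℂ[X]) (v : ℕ → W) :
    partialAct O N x v - partialAct O M x v ∈ fil W M := by
  induction N, h using Nat.le_induction with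
  | base => simp
  | succ N h ih =>
    have : partialAct O (N + 1) x v - partialAct O M x v
        = (partialAct O N x v - partialAct O M x v) + aeval O.a (x N) ((O.b ^ N) v) := by
      rw [partialAct, Finset.sum_range_succ, ← partialAct]; abel
    rw [this]
    refine (fil W M).add_mem ih (aeval_fil O _ (fil_mono h ?_))
    have := b_pow_fil O N (n := 0) (v := v) (fun m hm => absurd hm (Nat.not_lt_zero m))
    simpa using this

theorem act_sub_mem (M : ℕ) (x : ℕ → ℂ[X]) (v : ℕ → W) :
    act O x v - partialAct O M x v ∈ fil W M := by
  intro m hm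
  have := partialAct_sub_mem O (Nat.succ_le_of_lt hm) x v m (Nat.lt_succ_self m)
  have h2 : partialAct O M x v m = partialAct O (m + 1) x v m := sub_eq_zero.1 this
  simp [act, h2]

theorem act_add_left (x y : ℕ → ℂ[X]) (v : ℕ → W) :
    act O (x + y) v = act O x v + act O y v := by
  funext m
  simp [act, partialAct, Finset.sum_add_distrib]

theorem act_sub_left (x y : ℕ → ℂ[X]) (v : ℕ → W) :
    act O (x - y) v = act O x v - act O y v := by
  funext m
  simp [act, partialAct, Finset.sum_sub_distrib]

theorem act_smul_left (c : ℂ) (x : ℕ → ℂ[X]) (v : ℕ → W) :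
    act O (c • x) v = c • act O x v := by
  funext m
  simp [act, partialAct, Finset.smul_sum]

theorem act_add_right (x : ℕ → ℂ[X]) (u v : ℕ → W) :
    act O x (u + v) = act O x u + act O x v := by
  funext m
  simp [act, partialAct, Finset.sum_add_distrib]

theorem act_smul_right (c : ℂ) (x : ℕ → ℂ[X]) (v : ℕ → W) :
    act O x (c • v) = c • act O x v := by
  funext m
  simp [act, partialAct, Finset.smul_sum]

theorem act_zero_left (v : ℕ → W) : act O 0 v = 0 := by
  funext m
  simp [act, partialAct]

theorem act_zero_right (x : ℕ → ℂ[X]) : act O x (0 : ℕ → W) = 0 := by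
  funext m
  simp [act, partialAct]

theorem act_fil_right (x : ℕ → ℂ[X]) {n : ℕ} {v : ℕ → W} (hv : v ∈ fil W n) :
    act O x v ∈ fil W n := by
  intro m hm
  have : partialAct O (m + 1) x v ∈ fil W n :=
    (fil W n).sum_mem fun ν _ => aeval_fil O _ (fil_mono (Nat.le_add_right n ν) (b_pow_fil O ν hv))
  exact this m hm

theorem act_fil_left (v : ℕ → W) {n : ℕ} {x : ℕ → ℂ[X]} (hx : x ∈ fil ℂ[X] n) :
    act O x v ∈ fil W n := by
  intro m hm
  have : partialAct O (m + 1) x v = 0 := by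
    refine Finset.sum_eq_zero fun ν hν => ?_
    rw [hx ν (by have := Finset.mem_range.1 hν; omega)]
    simp
  simp [act, this]

/-- `b Q(a) = Q(a) b - b Q'(a) b`. -/
theorem b_aeval (Q : ℂ[X]) :
    O.b * aeval O.a Q = aeval O.a Q * O.b - O.b * aeval O.a (derivative Q) * O.b := by
  induction Q using Polynomial.induction_on with
  | C c => simp [Algebra.algebraMap_eq_smul_one]
  | add p q hp hq =>
    simp only [map_add, mul_add, add_mul, hp, hq]; abel
  | monomial n c ih =>
    have e : (C c * X ^ (n + 1) : ℂ[X]) = X * (C c * X ^ n) := by ring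
    rw [e]
    set q : ℂ[X] := C c * X ^ n with hq
    have hd : derivative (X * q) = q + X * derivative q := by
      simp [derivative_mul]
    rw [hd]
    simp only [map_add, map_mul, aeval_X]
    have hc : O.b * O.a = O.a * O.b - O.b * O.b := by rw [O.comm]; abel
    set A := O.a
    set B := O.b
    set q0 := aeval A q
    set q1 := aeval A (derivative q)
    have h1 : B * (A * q0) = A * (B * q0) - B * (B * q0) := by
      rw [← mul_assoc, hc, sub_mul, mul_assoc, mul_assoc]
    have h2 : B * (q0 + A * q1) * B = B * q0 * B + (A * (B * q1 * B) - B * (B * q1 * B)) := by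
      rw [mul_add, add_mul, ← mul_assoc B A q1, hc]
      simp only [sub_mul, mul_assoc]
    have h3 : A * (B * q0) = A * q0 * B - A * (B * q1 * B) := by
      rw [ih, mul_sub, mul_assoc A q0 B]
    have h4 : B * (B * q0) = B * q0 * B - B * (B * q1 * B) := by
      rw [mul_assoc B q0 B, ← mul_sub, ← ih]
    rw [h1, h2, h3, h4]
    abel

end Action

/-! ### The algebra `Ã` -/

/-- Left multiplication by `b` on series `∑ Q_j(a) b^j`, obtained from
`b Q(a) = ∑_k (-1)^k Q^{(k)}(a) b^{k+1}`, a consequence of `a b - b a = b²`. -/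
def leftB : Module.End ℂ (ℕ → ℂ[X]) where
  toFun y := fun n => match n with
    | 0 => 0
    | n + 1 => ∑ k ∈ Finset.range (n + 1), (-1 : ℂ) ^ k • (derivative^[k] (y (n - k)))
  map_add' y z := by
    funext n
    cases n with
    | zero => simp
    | succ n => simp [Finset.sum_add_distrib, iterate_map_add]
  map_smul' c y := by
    funext n
    cases n with
    | zero => simp
    | succ n =>
      simp only [Pi.smul_apply, RingHom.id_apply, Finset.smul_sum]
      refine Finset.sum_congr rfl fun k _ => ?_
      rw [iterate_derivative_smul, smul_comm]

theorem leftB_zero (y : ℕ → ℂ[X]) : leftB y 0 = 0 := rfl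

theorem leftB_succ (y : ℕ → ℂ[X]) (n : ℕ) :
    leftB y (n + 1) = y n - derivative (leftB y n) := by
  cases n with
  | zero => simp [leftB]
  | succ n =>
    change ∑ k ∈ Finset.range (n + 1 + 1), (-1 : ℂ) ^ k • (derivative^[k] (y (n + 1 - k))) =
      y (n + 1) - derivative
        (∑ k ∈ Finset.range (n + 1), (-1 : ℂ) ^ k • (derivative^[k] (y (n - k))))
    rw [Finset.sum_range_succ', map_sum, sub_eq_add_neg, add_comm, ← Finset.sum_neg_distrib]
    congr 1
    · simp
    · refine Finset.sum_congr rfl fun k _ => ?_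
      rw [derivative_smul, ← Function.iterate_succ_apply' (derivative), pow_succ]
      simp

/-- Left multiplication by `a` on series `∑ Q_j(a) b^j`. -/
def leftA : Module.End ℂ (ℕ → ℂ[X]) where
  toFun y := fun n => X * y n
  map_add' y z := by funext n; simp [mul_add]
  map_smul' c y := by funext n; simp

/-- Left multiplications by `a` and `b` on the series `∑ Q_j(a) b^j`. -/
def regular : Ops ℂ[X] where
  a := leftA
  b := leftB
  comm := by
    ext1 y
    funext n
    change X * leftB y n = leftB (leftA y) n + leftB (leftB y) n
    induction n with
    | zero => simp [leftB_zero]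
    | succ n ih =>
      have h : leftB (leftA y) n = X * leftB y n - leftB (leftB y) n := by rw [ih]; ring
      rw [leftB_succ, leftB_succ, leftB_succ, h]
      simp only [map_sub, derivative_mul, derivative_X]
      change _ = X * y n - _ + _
      ring
  a_fil := fun n v hv m hm => by
    change X * v m = 0
    rw [hv m hm, mul_zero]
  b_fil := fun n v hv m hm => by
    induction m with
    | zero => rfl
    | succ m ih => rw [leftB_succ, hv m (by omega), ih (by omega)]; simp

section Assoc

variable {W : Type*} [AddCommGroup W] [Module ℂ W] (O : Ops W)

theorem act_leftA (y : ℕ → ℂ[X]) (v : ℕ → W) : act O (leftA y) v = O.a (act O y v) := by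
  refine eq_of_fil fun n => ?_
  have h1 := act_sub_mem O n (leftA y) v
  have h2 := O.a_fil n _ (act_sub_mem O n y v)
  have h3 : partialAct O n (leftA y) v = O.a (partialAct O n y v) := by
    simp [partialAct, leftA, map_sum]
  rw [map_sub, ← h3] at h2
  simpa using (fil W n).sub_mem h1 h2

/-- Right multiplication by `b`. -/
def shift (y : ℕ → ℂ[X]) : ℕ → ℂ[X] := fun n => match n with
  | 0 => 0
  | n + 1 => y n

theorem act_shift (y : ℕ → ℂ[X]) (v : ℕ → W) : act O (shift y) v = act O y (O.b v) := by
  refine eq_of_fil fun n => ?_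
  have h1 := act_sub_mem O (n + 1) (shift y) v
  have h2 := act_sub_mem O n y (O.b v)
  have h3 : partialAct O (n + 1) (shift y) v = partialAct O n y (O.b v) := by
    rw [partialAct, Finset.sum_range_succ']
    simp [partialAct, shift, pow_succ]
  rw [h3] at h1
  simpa using (fil W n).sub_mem (fil_mono (Nat.le_succ n) h1) h2

/-- Termwise derivative with respect to `a`. -/
def deriv_a (y : ℕ → ℂ[X]) : ℕ → ℂ[X] := fun n => derivative (y n)

theorem leftB_eq (y : ℕ → ℂ[X]) : leftB y = shift y - shift (leftB (deriv_a y)) := by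
  have comm : ∀ n, derivative (leftB y n) = leftB (deriv_a y) n := by
    intro n
    induction n with
    | zero => simp [leftB_zero]
    | succ n ih => rw [leftB_succ, leftB_succ, ← ih]; simp [deriv_a]
  funext n
  cases n with
  | zero => simp [leftB_zero, shift]
  | succ n => rw [leftB_succ, comm]; rfl

theorem b_act (y : ℕ → ℂ[X]) (v : ℕ → W) :
    O.b (act O y v) = act O y (O.b v) - O.b (act O (deriv_a y) (O.b v)) := by
  refine eq_of_fil fun n => ?_
  have h1 := fil_mono (Nat.le_succ n) (O.b_fil n _ (act_sub_mem O n y v))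
  have h2 := act_sub_mem O n y (O.b v)
  have h3 := fil_mono (Nat.le_succ n) (O.b_fil n _ (act_sub_mem O n (deriv_a y) (O.b v)))
  have h4 : O.b (partialAct O n y v) =
      partialAct O n y (O.b v) - O.b (partialAct O n (deriv_a y) (O.b v)) := by
    simp only [partialAct, map_sum, ← Finset.sum_sub_distrib]
    refine Finset.sum_congr rfl fun ν _ => ?_
    have := congrArg (fun T : Module.End ℂ (ℕ → W) => T ((O.b ^ ν) v)) (b_aeval O (y ν))
    simp only [Module.End.mul_apply, LinearMap.sub_apply] at this
    rw [this]
    have hb : O.b ((O.b ^ ν) v) = (O.b ^ ν) (O.b v) := by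
      rw [← Module.End.mul_apply, ← Module.End.mul_apply, (Commute.self_pow O.b ν).eq]
    rw [hb]
    rfl
  rw [map_sub] at h1 h3
  rw [h4] at h1
  convert (fil W n).sub_mem h1 ((fil W n).sub_mem h2 h3) using 1
  abel

theorem act_leftB (y : ℕ → ℂ[X]) (v : ℕ → W) : act O (leftB y) v = O.b (act O y v) := by
  have key : ∀ (n : ℕ) (y : ℕ → ℂ[X]) (k : ℕ) (v : ℕ → W), v ∈ fil W k →
      act O (leftB y) v - O.b (act O y v) ∈ fil W (k + n) := by
    intro n
    induction n with
    | zero =>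
      intro y k v hv
      exact (fil W k).sub_mem (act_fil_right O _ hv)
        (fil_mono (Nat.le_succ k) (O.b_fil _ _ (act_fil_right O _ hv)))
    | succ n ih =>
      intro y k v hv
      have e : act O (leftB y) v - O.b (act O y v) =
          -(act O (leftB (deriv_a y)) (O.b v) - O.b (act O (deriv_a y) (O.b v))) := by
        rw [leftB_eq y, act_sub_left, act_shift, act_shift, b_act O y v]
        abel
      rw [e]
      have := ih (deriv_a y) (k + 1) (O.b v) (O.b_fil _ _ hv)
      rw [show k + (n + 1) = k + 1 + n by ring]
      exact (fil W _).neg_mem this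
  refine eq_of_fil fun n => ?_
  have := key n y 0 v (fun m hm => absurd hm (Nat.not_lt_zero m))
  simpa using this

theorem act_aeval_leftA (P : ℂ[X]) (y : ℕ → ℂ[X]) (v : ℕ → W) :
    act O (aeval leftA P y) v = aeval O.a P (act O y v) := by
  induction P using Polynomial.induction_on' with
  | add p q hp hq => simp [act_add_left, hp, hq]
  | monomial k c =>
    have : ∀ k, act O ((leftA ^ k) y) v = (O.a ^ k) (act O y v) := by
      intro k
      induction k with
      | zero => simp
      | succ k ih => rw [pow_succ', pow_succ', Module.End.mul_apply, act_leftA, ih]; rfl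
    simp [aeval_monomial, act_smul_left, this]

theorem act_leftB_pow (k : ℕ) (y : ℕ → ℂ[X]) (v : ℕ → W) :
    act O ((leftB ^ k) y) v = (O.b ^ k) (act O y v) := by
  induction k with
  | zero => simp
  | succ k ih => rw [pow_succ', pow_succ', Module.End.mul_apply, act_leftB, ih]; rfl

theorem act_assoc (x y : ℕ → ℂ[X]) (v : ℕ → W) :
    act O (act regular x y) v = act O x (act O y v) := by
  refine eq_of_fil fun n => ?_
  have h1 := act_fil_left O v (act_sub_mem regular n x y)
  have h2 := act_sub_mem O n x (act O y v)
  rw [act_sub_left] at h1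
  have h3 : act O (partialAct regular n x y) v = partialAct O n x (act O y v) := by
    have hs : ∀ s : Finset ℕ,
        act O (∑ ν ∈ s, aeval regular.a (x ν) ((regular.b ^ ν) y)) v =
          ∑ ν ∈ s, aeval O.a (x ν) ((O.b ^ ν) (act O y v)) := by
      intro s
      induction s using Finset.induction_on with
      | empty => simp [act_zero_left]
      | insert i s hi ih =>
        rw [Finset.sum_insert hi, Finset.sum_insert hi, act_add_left, ih]
        congr 1
        rw [← act_leftB_pow, ← act_aeval_leftA]
        rfl
    exact hs _
  rw [h3] at h1
  simpa using (fil W n).sub_mem h1 h2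

/-- The series `1`. -/
def oneSeries : ℕ → ℂ[X] := fun n => if n = 0 then 1 else 0

theorem act_one (v : ℕ → W) : act O oneSeries v = v := by
  funext m
  refine (act_apply _ _ _ _).trans ?_
  rw [Finset.sum_eq_single 0]
  · simp [oneSeries]
  · intro ν _ hν; simp [oneSeries, hν]
  · simp

end Assoc

theorem leftB_const (f : ℕ → ℂ) :
    leftB (fun n => C (f n)) = shift (fun n => C (f n)) := by
  rw [leftB_eq]
  have : deriv_a (fun n => C (f n)) = 0 := by funext n; simp [deriv_a]
  rw [this, map_zero]
  have : shift 0 = 0 := by funext n; cases n <;> simp [shift]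
  rw [this, sub_zero]

theorem leftB_pow_const (k : ℕ) (f : ℕ → ℂ) :
    (leftB ^ k) (fun n => C (f n)) = fun n => if k ≤ n then C (f (n - k)) else 0 := by
  induction k with
  | zero => simp
  | succ k ih =>
    rw [pow_succ', Module.End.mul_apply, ih]
    have : (fun n => if k ≤ n then C (f (n - k)) else 0) =
        fun n => (C (if k ≤ n then f (n - k) else 0) : ℂ[X]) := by
      funext n; split_ifs <;> simp
    rw [this, leftB_const]
    funext n
    cases n with
    | zero => simp [shift]
    | succ n =>
      simp only [shift, Nat.add_le_add_iff_right, Nat.add_sub_add_right]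
      split_ifs <;> simp

theorem aeval_leftA (P : ℂ[X]) (y : ℕ → ℂ[X]) (n : ℕ) : aeval leftA P y n = P * y n := by
  induction P using Polynomial.induction_on' with
  | add p q hp hq => simp [add_mul, hp, hq]
  | monomial k c =>
    have : ∀ k, (leftA ^ k) y n = X ^ k * y n := by
      intro k
      induction k with
      | zero => simp
      | succ k ih =>
        rw [pow_succ', Module.End.mul_apply]
        change X * (leftA ^ k) y n = _
        rw [ih]; ring
    simp [this, ← C_mul_X_pow_eq_monomial, smul_eq_C_mul, mul_assoc]

/-- The algebra `Ã`: its elements are the formal series `∑_ν P_ν(a) b^ν` with `P_ν ∈ ℂ[a]`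
(see `Atilde.coeffs`), multiplied by means of `a b - b a = b²`. It is the
`b`-adic completion of the algebra generated by `a`, `b` with that relation. -/
def Atilde : Type := ℕ → ℂ[X]

namespace Atilde

instance : AddCommGroup Atilde := inferInstanceAs (AddCommGroup (ℕ → ℂ[X]))
instance : Module ℂ Atilde := inferInstanceAs (Module ℂ (ℕ → ℂ[X]))

/-- The coefficients of an element of `Ã`: `∑_ν P_ν(a) b^ν ↦ (P_ν)`. -/
def coeffs : Atilde ≃ₗ[ℂ] (ℕ → ℂ[X]) := LinearEquiv.refl ℂ _

/-- The product: `∑ P_ν(a) b^ν` acts on `y` through left multiplication by `a` and by `b`. -/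
instance : Mul Atilde := ⟨fun x y => coeffs.symm (act regular (coeffs x) (coeffs y))⟩
instance : One Atilde := ⟨coeffs.symm oneSeries⟩

theorem coeffs_mul (x y : Atilde) : coeffs (x * y) = act regular (coeffs x) (coeffs y) := rfl

theorem coeffs_one : coeffs 1 = oneSeries := rfl

theorem oneSeries_eq : oneSeries = fun n => C (if n = 0 then (1 : ℂ) else 0) := by
  funext n; simp only [oneSeries]; split_ifs <;> simp

theorem act_oneSeries (x : ℕ → ℂ[X]) : act regular x oneSeries = x := by
  funext m
  refine (act_apply _ _ _ _).trans ?_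
  rw [Finset.sum_eq_single m]
  · change aeval leftA (x m) ((leftB ^ m) oneSeries) m = x m
    rw [aeval_leftA, oneSeries_eq, leftB_pow_const]
    simp
  · intro ν hν hne
    have : ν < m := lt_of_le_of_ne (Nat.lt_succ_iff.1 (Finset.mem_range.1 hν)) hne
    change aeval leftA (x ν) ((leftB ^ ν) oneSeries) m = 0
    rw [aeval_leftA, oneSeries_eq, leftB_pow_const]
    have h0 : m - ν ≠ 0 := by omega
    simp [h0]
  · simp

instance : Ring Atilde :=
  { (inferInstance : AddCommGroup Atilde) with
    mul := (· * ·)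
    one := 1
    left_distrib := fun x y z => act_add_right regular x y z
    right_distrib := fun x y z => act_add_left regular x y z
    zero_mul := fun x => act_zero_left regular x
    mul_zero := fun x => act_zero_right regular x
    mul_assoc := fun x y z => act_assoc regular x y z
    one_mul := fun x => act_one regular x
    mul_one := fun x => act_oneSeries x }

instance : Algebra ℂ Atilde :=
  Algebra.ofModule (fun c x y => act_smul_left regular c x y)
    (fun c x y => act_smul_right regular c x y)

/-- The element `a`. -/
def a : Atilde := coeffs.symm fun n => if n = 0 then X else 0

/-- The element `b`. -/
def b : Atilde := coeffs.symm fun n => if n = 1 then 1 else 0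

/-- The inclusion `ℂ[[b]] ⊂ Ã`. -/
def ofPowerSeries : PowerSeries ℂ →+* Atilde where
  toFun f := coeffs.symm fun n => C (PowerSeries.coeff n f)
  map_one' := by
    apply coeffs.injective
    rw [LinearEquiv.apply_symm_apply, coeffs_one, oneSeries_eq]
    funext n
    rw [PowerSeries.coeff_one]
  map_zero' := by
    apply coeffs.injective
    funext n
    simp
  map_add' f g := by
    apply coeffs.injective
    funext n
    simp
  map_mul' f g := by
    apply coeffs.injective
    rw [coeffs_mul]
    simp only [LinearEquiv.apply_symm_apply]
    funext n
    refine Eq.trans ?_ (act_apply _ _ _ _).symm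
    rw [PowerSeries.coeff_mul, map_sum,
      Finset.Nat.sum_antidiagonal_eq_sum_range_succ
        (fun i j => C (PowerSeries.coeff i f * PowerSeries.coeff j g))]
    refine Finset.sum_congr rfl fun ν hν => ?_
    change _ = aeval leftA _ ((leftB ^ ν) _) n
    rw [aeval_leftA, leftB_pow_const]
    simp only [if_pos (Nat.lt_succ_iff.1 (Finset.mem_range.1 hν)), C_mul]

theorem coeffs_a_mul (x : Atilde) : coeffs (a * x) = leftA (coeffs x) := by
  rw [coeffs_mul]
  funext m
  refine (act_apply _ _ _ _).trans ?_
  rw [Finset.sum_eq_single 0]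
  · have h : coeffs a 0 = X := rfl
    rw [h, pow_zero, aeval_X]
    rfl
  · intro ν _ hν; simp [a, hν]
  · simp

theorem coeffs_b_mul (x : Atilde) : coeffs (b * x) = leftB (coeffs x) := by
  rw [coeffs_mul]
  refine eq_of_fil fun n => ?_
  have h := act_sub_mem regular (n + 2) (coeffs b) (coeffs x)
  have h2 : partialAct regular (n + 2) (coeffs b) (coeffs x) = leftB (coeffs x) := by
    refine (Finset.sum_eq_single 1 ?_ ?_).trans ?_
    · intro ν _ hν; simp [b, hν]
    · intro h; exact absurd (Finset.mem_range.2 (by omega)) h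
    · simp [b, regular]
  rw [h2] at h
  exact fil_mono (by omega) h

/-- The commutation relation `a b - b a = b²`. -/
theorem a_mul_b : a * b - b * a = b ^ 2 := by
  have h := congrArg (fun T : Module.End ℂ (ℕ → ℂ[X]) => T (coeffs 1)) regular.comm
  change leftA (leftB (coeffs 1)) = leftB (leftA (coeffs 1)) + leftB (leftB (coeffs 1)) at h
  rw [← coeffs_a_mul, ← coeffs_b_mul, mul_one, mul_one, ← coeffs_a_mul, ← coeffs_b_mul,
    ← coeffs_b_mul, ← map_add] at h
  rw [coeffs.injective h, pow_two]; abel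

theorem coeffs_aeval_a_mul (P : ℂ[X]) (x : Atilde) (n : ℕ) :
    coeffs (aeval a P * x) n = P * coeffs x n := by
  induction P using Polynomial.induction_on' with
  | add p q hp hq => simp [add_mul, hp, hq]
  | monomial k c =>
    have : ∀ k : ℕ, coeffs (a ^ k * x) n = X ^ k * coeffs x n := by
      intro k
      induction k with
      | zero => simp
      | succ k ih =>
        rw [pow_succ', mul_assoc, coeffs_a_mul]
        change X * coeffs (a ^ k * x) n = _
        rw [ih, pow_succ', mul_assoc]
    rw [aeval_monomial, mul_assoc, ← Algebra.smul_def, map_smul, Pi.smul_apply, this,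
      ← C_mul_X_pow_eq_monomial, smul_eq_C_mul, mul_assoc]

/-- The series with the single term `P(a) b^n` is the product of `P(a)` and `b^n` in `Ã`. -/
theorem aeval_a_mul_b_pow (P : ℂ[X]) (n : ℕ) :
    aeval a P * b ^ n = coeffs.symm fun m => if m = n then P else 0 := by
  have h2 : ∀ n : ℕ, coeffs (b ^ n) = (leftB ^ n) (coeffs 1) := by
    intro n
    induction n with
    | zero => simp
    | succ n ih => rw [pow_succ', coeffs_b_mul, ih, pow_succ']; rfl
  apply coeffs.injective
  funext m
  rw [coeffs_aeval_a_mul, h2, coeffs_one, oneSeries_eq, leftB_pow_const,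
    LinearEquiv.apply_symm_apply]
  by_cases h : m = n
  · simp [h]
  · rcases Nat.lt_or_gt_of_ne h with h' | h'
    · simp [h, Nat.not_le.2 h']
    · have : m - n ≠ 0 := by omega
      simp [h, this]

end Atilde

open Atilde

/-! ### Homogeneous elements and Bernstein polynomials -/

/-- `P` is homogeneous of degree `k` in `(a, b)` and monic in `a`:
`P = a^k + c_1 a^{k-1} b + ⋯ + c_k b^k`. -/
def IsHomogeneousMonic (k : ℕ) (P : Atilde) : Prop :=
  ∃ c : ℕ → ℂ, c 0 = 1 ∧ P = ∑ i ∈ Finset.range (k + 1), c i • (a ^ (k - i) * b ^ i)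

/-- The element `b^j (b⁻¹ a)^j = (a - (j-1) b) ⋯ (a - b) a` of `Ã`. -/
def eulerProd : ℕ → Atilde
  | 0 => 1
  | j + 1 => (a - (j : ℂ) • b) * eulerProd j

/-- The element `(-b)^k B(-b⁻¹ a)` of `Ã`, for a polynomial `B = ∑ B_j x^j` of degree at most `k`,
written without denominators: `∑_j (-1)^{k-j} B_j b^{k-j} (b^j (b⁻¹ a)^j)`.
See `map_bernsteinElement`. -/
def bernsteinElement (k : ℕ) (B : ℂ[X]) : Atilde :=
  ∑ j ∈ Finset.range (k + 1), ((-1 : ℂ) ^ (k - j) * B.coeff j) • (b ^ (k - j) * eulerProd j)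

/-- `B` is the Bernstein polynomial `B_P` of `P`, homogeneous of degree `k` and monic in `a`:
`(-b)^k B(-b⁻¹ a) = P`. It exists and is unique, see `existsUnique_isBernsteinPoly`. -/
def IsBernsteinPoly (k : ℕ) (P : Atilde) (B : ℂ[X]) : Prop :=
  B.natDegree ≤ k ∧ bernsteinElement k B = P

theorem a_b_pow (n : ℕ) : b ^ n * a = (a - (n : ℂ) • b) * b ^ n := by
  have h : b * a = a * b - b * b := by rw [← pow_two, ← a_mul_b]; abel
  induction n with
  | zero => simp
  | succ n ih =>
    rw [pow_succ', mul_assoc, ih, ← mul_assoc, mul_sub, h, ← mul_assoc]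
    push_cast
    simp only [mul_smul_comm, add_smul, sub_mul, add_mul, smul_mul_assoc, one_smul, mul_assoc]
    abel

/-- In every algebra over `Ã` in which `b` is invertible (with inverse `u`), `bernsteinElement k B` is
`(-b)^k B(-b⁻¹ a)`. -/
theorem map_bernsteinElement {S : Type*} [Ring S] [Algebra ℂ S] (φ : Atilde →ₐ[ℂ] S) (u : S)
    (hu : φ b * u = 1) (k : ℕ) (B : ℂ[X]) (hB : B.natDegree ≤ k) :
    φ (bernsteinElement k B) = (-φ b) ^ k * aeval (-(u * φ a)) B := by
  have hE : ∀ j, φ (eulerProd j) = φ b ^ j * (u * φ a) ^ j := by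
    intro j
    induction j with
    | zero => simp [eulerProd]
    | succ j ih =>
      have := congrArg φ (a_b_pow j)
      rw [map_mul, map_mul, map_pow] at this
      rw [eulerProd, map_mul, ih, ← mul_assoc, ← this, pow_succ (φ b), pow_succ' (u * φ a)]
      calc φ b ^ j * φ a * (u * φ a) ^ j = φ b ^ j * (φ b * u) * φ a * (u * φ a) ^ j := by
            rw [hu, mul_one]
        _ = _ := by simp only [mul_assoc]
  rw [bernsteinElement, map_sum, aeval_eq_sum_range' (Nat.lt_succ_of_le hB), Finset.mul_sum]
  refine Finset.sum_congr rfl fun j hj => ?_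
  have hjk : j ≤ k := Nat.lt_succ_iff.1 (Finset.mem_range.1 hj)
  obtain ⟨i, rfl⟩ := Nat.exists_eq_add_of_le' hjk
  rw [map_smul, map_mul, map_pow, hE, Nat.add_sub_cancel, mul_smul_comm, neg_pow (φ b),
    neg_pow (u * φ a), ← mul_assoc, ← pow_add, mul_comm ((-1 : ℂ) ^ i), mul_smul]
  congr 1
  have h1 : ∀ n : ℕ, ((-1 : S) ^ n) = algebraMap ℂ S ((-1) ^ n) := by intro n; simp
  rw [h1, h1, ← Algebra.smul_def, ← Algebra.smul_def, smul_mul_assoc, mul_smul_comm, smul_smul]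
  congr 1
  rw [pow_add, mul_assoc, ← mul_pow]
  simp

theorem coeffs_eulerProd_zero (j : ℕ) : coeffs (eulerProd j) 0 = X ^ j := by
  induction j with
  | zero => rfl
  | succ j ih =>
    rw [eulerProd, sub_mul, smul_mul_assoc, map_sub, map_smul, coeffs_a_mul, coeffs_b_mul]
    change X * coeffs (eulerProd j) 0 - (j : ℂ) • leftB (coeffs (eulerProd j)) 0 = _
    rw [leftB_zero, ih]
    simp [pow_succ']

theorem coeffs_b_pow_mul (x : Atilde) (n m : ℕ) (h : m ≤ n) :
    coeffs (b ^ n * x) m = if m = n then coeffs x 0 else 0 := by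
  induction n generalizing m with
  | zero => obtain rfl := Nat.le_zero.1 h; simp
  | succ n ih =>
    rw [pow_succ', mul_assoc, coeffs_b_mul]
    cases m with
    | zero => simp [leftB_zero]
    | succ m =>
      have hz : leftB (coeffs (b ^ n * x)) m = 0 := by
        have hf : coeffs (b ^ n * x) ∈ fil ℂ[X] n := fun i hi => by
          rw [ih i hi.le, if_neg hi.ne]
        exact regular.b_fil n _ hf m (by omega)
      rw [leftB_succ, hz, ih m (by omega)]
      simp

theorem bernsteinElement_injective (k : ℕ) (B : ℂ[X]) (hB : B.natDegree ≤ k)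
    (h : bernsteinElement k B = 0) : B = 0 := by
  have key : ∀ m, ∀ j, j + m = k → B.coeff j = 0 := by
    intro m
    induction m using Nat.strong_induction_on with
    | _ m ih =>
      intro j hj
      have h0 : coeffs (bernsteinElement k B) m = 0 := by rw [h, map_zero]; rfl
      have h1 : coeffs (bernsteinElement k B) m = ∑ i ∈ Finset.range (k + 1),
          ((-1 : ℂ) ^ (k - i) * B.coeff i) • coeffs (b ^ (k - i) * eulerProd i) m := by
        simp [bernsteinElement, map_sum]
      rw [h1, Finset.sum_eq_single j] at h0
      · have hkj : k - j = m := by omega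
        rw [hkj, coeffs_b_pow_mul _ _ _ le_rfl, if_pos rfl, coeffs_eulerProd_zero] at h0
        have := (smul_eq_zero.1 h0).resolve_right (pow_ne_zero _ X_ne_zero)
        simpa using this
      · intro i hi hne
        have hik := Finset.mem_range.1 hi
        by_cases hlt : i < j
        · rw [coeffs_b_pow_mul _ _ _ (by omega), if_neg (by omega), smul_zero]
        · rw [ih (k - i) (by omega) i (by omega)]; simp
      · intro hn; exact absurd (Finset.mem_range.2 (by omega)) hn
  ext j
  by_cases hj : j ≤ k
  · simpa using key (k - j) j (by omega)
  · simpa using coeff_eq_zero_of_natDegree_lt (by omega)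

theorem bernsteinElement_add (k : ℕ) (B B' : ℂ[X]) :
    bernsteinElement k (B + B') = bernsteinElement k B + bernsteinElement k B' := by
  simp [bernsteinElement, mul_add, add_smul, Finset.sum_add_distrib]

theorem bernsteinElement_smul (k : ℕ) (c : ℂ) (B : ℂ[X]) :
    bernsteinElement k (c • B) = c • bernsteinElement k B := by
  simp only [bernsteinElement, Finset.smul_sum, coeff_smul, smul_eq_mul, smul_smul]
  refine Finset.sum_congr rfl fun j _ => ?_
  congr 1; ring

theorem bernsteinElement_X_mul (k : ℕ) (B : ℂ[X]) (hB : B.natDegree ≤ k) :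
    bernsteinElement (k + 1) ((X - C (k : ℂ)) * B) = a * bernsteinElement k B := by
  have hX : bernsteinElement (k + 1) (X * B) = ∑ j ∈ Finset.range (k + 1),
      ((-1 : ℂ) ^ (k - j) * B.coeff j) • (b ^ (k - j) * eulerProd (j + 1)) := by
    rw [bernsteinElement, Finset.sum_range_succ']
    simp
  have hC : bernsteinElement (k + 1) (C (k : ℂ) * B) = ∑ j ∈ Finset.range (k + 1),
      ((-1 : ℂ) ^ (k - j) * B.coeff j) • (-(k : ℂ) • (b * (b ^ (k - j) * eulerProd j))) := by
    rw [bernsteinElement, Finset.sum_range_succ]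
    rw [coeff_C_mul, coeff_eq_zero_of_natDegree_lt (Nat.lt_succ_of_le hB)]
    simp only [mul_zero, zero_smul, add_zero]
    refine Finset.sum_congr rfl fun j hj => ?_
    have : k + 1 - j = (k - j) + 1 := by have := Finset.mem_range.1 hj; omega
    rw [this, coeff_C_mul, pow_succ' b, mul_assoc b, smul_smul]
    congr 1
    ring
  have hs : (X - C (k : ℂ)) * B = X * B + (-1 : ℂ) • (C (k : ℂ) * B) := by
    rw [sub_mul, neg_smul, one_smul, sub_eq_add_neg]
  rw [hs, bernsteinElement_add, bernsteinElement_smul, hX, hC, bernsteinElement, Finset.mul_sum,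
    Finset.smul_sum, ← Finset.sum_add_distrib]
  refine Finset.sum_congr rfl fun j hj => ?_
  have hjk : j ≤ k := Nat.lt_succ_iff.1 (Finset.mem_range.1 hj)
  rw [mul_smul_comm, smul_comm (-1 : ℂ), ← smul_add]
  congr 1
  have h1 := a_b_pow (k - j)
  have h2 : a * b ^ (k - j) = b ^ (k - j) * a + ((k - j : ℕ) : ℂ) • (b * b ^ (k - j)) := by
    rw [h1, sub_mul, smul_mul_assoc]; abel
  rw [← mul_assoc a, h2, eulerProd, add_mul, sub_mul, mul_sub, smul_mul_assoc, smul_mul_assoc,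
    mul_smul_comm, ← mul_assoc (b ^ (k - j)) b, ← pow_succ, ← pow_succ', mul_assoc _ a,
    ← mul_assoc b, ← pow_succ', smul_smul, Nat.cast_sub hjk, sub_smul]
  module

/-- Existence and uniqueness of the Bernstein polynomial. -/
theorem existsUnique_isBernsteinPoly (k : ℕ) (P : Atilde) (hP : IsHomogeneousMonic k P) :
    ∃! B, IsBernsteinPoly k P B := by
  have hmon : ∀ i j : ℕ, ∃ B : ℂ[X], B.natDegree ≤ j + i ∧
      bernsteinElement (j + i) B = a ^ j * b ^ i := by
    intro i j
    induction j with
    | zero =>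
      refine ⟨C ((-1) ^ i), by simp, ?_⟩
      rw [bernsteinElement, Finset.sum_eq_single 0]
      · rw [coeff_C_zero, Nat.sub_zero, zero_add, ← mul_pow]
        simp [eulerProd]
      · intro j _ hj; rw [coeff_C_of_ne_zero hj]; simp
      · simp
    | succ j ih =>
      obtain ⟨B, hd, hB⟩ := ih
      refine ⟨(X - C ((j + i : ℕ) : ℂ)) * B, ?_, ?_⟩
      · refine natDegree_mul_le.trans ?_
        rw [natDegree_X_sub_C]; omega
      · rw [show j + 1 + i = j + i + 1 by ring, bernsteinElement_X_mul _ _ hd, hB, pow_succ',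
          mul_assoc]
  obtain ⟨c, -, rfl⟩ := hP
  have hex : ∀ s : Finset ℕ, (∀ i ∈ s, i ≤ k) → ∃ B : ℂ[X], B.natDegree ≤ k ∧
      bernsteinElement k B = ∑ i ∈ s, c i • (a ^ (k - i) * b ^ i) := by
    intro s
    induction s using Finset.induction_on with
    | empty => exact fun _ => ⟨0, by simp, by simp [bernsteinElement]⟩
    | insert i s hi ih =>
      intro hs
      obtain ⟨B, hd, hB⟩ := ih fun j hj => hs j (Finset.mem_insert_of_mem hj)
      obtain ⟨B', hd', hB'⟩ := hmon i (k - i)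
      have hik := hs i (Finset.mem_insert_self i s)
      rw [Nat.sub_add_cancel hik] at hd' hB'
      refine ⟨c i • B' + B, ?_, ?_⟩
      · exact natDegree_add_le_of_degree_le ((natDegree_smul_le _ _).trans hd') hd
      · rw [bernsteinElement_add, bernsteinElement_smul, hB, hB', Finset.sum_insert hi]
  obtain ⟨B, hd, hB⟩ := hex (Finset.range (k + 1))
    (fun i hi => Nat.lt_succ_iff.1 (Finset.mem_range.1 hi))
  refine ⟨B, ⟨hd, hB⟩, ?_⟩
  rintro B' ⟨hd', hB'⟩
  refine sub_eq_zero.1 (bernsteinElement_injective k (B' - B)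
    ((natDegree_sub_le _ _).trans (max_le hd' hd)) ?_)
  have : B' - B = B' + (-1 : ℂ) • B := by simp [sub_eq_add_neg]
  rw [this, bernsteinElement_add, bernsteinElement_smul, hB, hB']
  simp

/-! ### Asymptotic expansions and themes -/

/-- Differentiation with respect to `L` on the polynomials `∑_{j ≤ N} w_j L^j`. -/
def derivLog (N : ℕ) : Module.End ℂ (Fin (N + 1) → ℂ) where
  toFun w := fun j => if h : (j : ℕ) + 1 < N + 1 then ((j : ℕ) + 1 : ℂ) * w ⟨j + 1, h⟩ else 0
  map_add' w w' := by
    funext j; simp only [Pi.add_apply]; split_ifs <;> ring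
  map_smul' c w := by
    funext j; simp only [Pi.smul_apply, smul_eq_mul, RingHom.id_apply]; split_ifs <;> ring

/-- `(t + D)⁻¹ = ∑_k (-1)^k t^{-k-1} D^k` for `t ≠ 0`, where `D` is `derivLog N`. -/
def logInv (N : ℕ) (t : ℂ) : Module.End ℂ (Fin (N + 1) → ℂ) :=
  ∑ k ∈ Finset.range (N + 1), ((-1) ^ k * (t⁻¹) ^ (k + 1)) • (derivLog N) ^ k

theorem derivLog_pow (N : ℕ) : (derivLog N) ^ (N + 1) = 0 := by
  have h : ∀ (k : ℕ) (w : Fin (N + 1) → ℂ) (j : Fin (N + 1)), N < j + k →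
      ((derivLog N) ^ k) w j = 0 := by
    intro k
    induction k with
    | zero => intro w j hj; have := j.2; omega
    | succ k ih =>
      intro w j hj
      rw [pow_succ', Module.End.mul_apply]
      change (if h : (j : ℕ) + 1 < N + 1 then
        ((j : ℕ) + 1 : ℂ) * ((derivLog N) ^ k) w ⟨j + 1, h⟩ else 0) = 0
      split_ifs with hlt
      · rw [ih w ⟨j + 1, hlt⟩ (by simp only; omega), mul_zero]
      · rfl
  refine LinearMap.ext fun w => funext fun j => ?_
  exact h (N + 1) w j (by omega)

theorem logInv_mul (N : ℕ) {t : ℂ} (ht : t ≠ 0) :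
    (t • 1 + derivLog N) * logInv N t = 1 := by
  have h : ∀ M : ℕ, (t • 1 + derivLog N) *
      (∑ k ∈ Finset.range M, ((-1) ^ k * (t⁻¹) ^ (k + 1)) • (derivLog N) ^ k) +
        ((-1) ^ M * (t⁻¹) ^ M) • (derivLog N) ^ M = 1 := by
    intro M
    induction M with
    | zero => simp
    | succ M ih =>
      refine Eq.trans ?_ ih
      rw [Finset.sum_range_succ, mul_add, add_assoc]
      congr 1
      rw [add_mul, smul_mul_assoc, one_mul, smul_smul, mul_smul_comm, ← pow_succ']
      have e : t * ((-1) ^ M * t⁻¹ ^ (M + 1)) = (-1) ^ M * t⁻¹ ^ M := by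
        rw [pow_succ]; field_simp
      have e' : (-1 : ℂ) ^ (M + 1) * t⁻¹ ^ (M + 1) = -((-1) ^ M * t⁻¹ ^ (M + 1)) := by ring
      rw [e, e', add_assoc, ← add_smul, add_neg_cancel, zero_smul, add_zero]
  have := h (N + 1)
  rwa [derivLog_pow, smul_zero, add_zero] at this

theorem mul_logInv (N : ℕ) {t : ℂ} (ht : t ≠ 0) :
    logInv N t * (t • 1 + derivLog N) = 1 := by
  have : Commute (logInv N t) (t • 1 + derivLog N) := by
    refine Commute.sum_left _ _ _ fun k _ => ?_
    refine Commute.smul_left ?_ _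
    exact ((Commute.one_right _).smul_right _).add_right ((Commute.refl _).pow_left k)
  rw [this.eq, logInv_mul N ht]

/-- The space `Ξ_α^{(N)} = ⨁_{j ≤ N} ℂ[[s]] s^{α-1} (Log s)^j` of formal asymptotic expansions,
`α ∈ ]0, 1]`: the family `φ` stands for `∑_m ∑_{j ≤ N} (φ m j) s^{α-1+m} (Log s)^j`. -/
def Xi (_α : Set.Ioc (0 : ℚ) 1) (N : ℕ) : Type := ℕ → (Fin (N + 1) → ℂ)

namespace Xi

variable (α : Set.Ioc (0 : ℚ) 1) (N : ℕ)

instance : AddCommGroup (Xi α N) := inferInstanceAs (AddCommGroup (ℕ → (Fin (N + 1) → ℂ)))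
instance : Module ℂ (Xi α N) := inferInstanceAs (Module ℂ (ℕ → (Fin (N + 1) → ℂ)))

/-- Multiplication by `s`. -/
def mulS : Module.End ℂ (ℕ → (Fin (N + 1) → ℂ)) where
  toFun φ := fun n => match n with
    | 0 => 0
    | n + 1 => φ n
  map_add' φ ψ := by funext n; cases n <;> simp
  map_smul' c φ := by funext n; cases n <;> simp

/-- Integration without constant: the term `s^{α-1+m} p(Log s)` has the primitive
`s^{α+m} ((α + m + D)⁻¹ p)(Log s)`, where `D` is the derivative of polynomials. -/
def integ : Module.End ℂ (ℕ → (Fin (N + 1) → ℂ)) where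
  toFun φ := fun n => match n with
    | 0 => 0
    | n + 1 => logInv N (((α : ℚ) : ℂ) + n) (φ n)
  map_add' φ ψ := by funext n; cases n <;> simp
  map_smul' c φ := by funext n; cases n <;> simp

theorem exponent_ne_zero (m : ℕ) : (((α : ℚ) : ℂ) + m) ≠ 0 := by
  have h : (0 : ℚ) < (α : ℚ) + m := add_pos_of_pos_of_nonneg α.2.1 (Nat.cast_nonneg m)
  exact_mod_cast h.ne'

/-- `d/ds` of the primitive is the given series. -/
theorem deriv_integ (φ : ℕ → (Fin (N + 1) → ℂ)) (m : ℕ) :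
    (((α : ℚ) : ℂ) + m) • integ α N φ (m + 1) + derivLog N (integ α N φ (m + 1)) = φ m :=
  congrArg (fun T : Module.End ℂ (Fin (N + 1) → ℂ) => T (φ m))
    (logInv_mul N (exponent_ne_zero α m))

/-- `a` is the multiplication by `s` and `b` is the integration without constant. -/
def ops : Ops (Fin (N + 1) → ℂ) where
  a := mulS N
  b := integ α N
  comm := by
    ext1 φ
    funext n
    match n with
    | 0 => exact (add_zero _).symm
    | 1 =>
      change (0 : Fin (N + 1) → ℂ) = logInv N _ 0 + logInv N _ 0
      simp
    | n + 2 =>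
      set t : ℂ := ((α : ℚ) : ℂ) + n with ht
      have ht' : ((α : ℚ) : ℂ) + ((n + 1 : ℕ) : ℂ) = t + 1 := by rw [ht]; push_cast; ring
      have h0 : t ≠ 0 := exponent_ne_zero α n
      have h1 : t + 1 ≠ 0 := by rw [← ht']; exact exponent_ne_zero α (n + 1)
      change logInv N (((α : ℚ) : ℂ) + n) (φ n) =
        logInv N (((α : ℚ) : ℂ) + ((n + 1 : ℕ) : ℂ)) (φ n) +
          logInv N (((α : ℚ) : ℂ) + ((n + 1 : ℕ) : ℂ)) (logInv N (((α : ℚ) : ℂ) + n) (φ n))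
      rw [ht', ← ht]
      have key : logInv N t = logInv N (t + 1) + logInv N (t + 1) * logInv N t := by
        have e1 : logInv N (t + 1) * (((t + 1) • 1 + derivLog N) * logInv N t) = logInv N t := by
          rw [← mul_assoc, mul_logInv N h1, one_mul]
        have e2 : ((t + 1) • 1 + derivLog N) * logInv N t = 1 + logInv N t := by
          have : ((t + 1) • 1 + derivLog N : Module.End ℂ (Fin (N + 1) → ℂ)) =
              (t • 1 + derivLog N) + 1 := by module
          rw [this, add_mul, logInv_mul N h0, one_mul]
        rw [e2, mul_add, mul_one] at e1
        exact e1.symm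
      exact congrArg (fun T : Module.End ℂ (Fin (N + 1) → ℂ) => T (φ n)) key
  a_fil := fun n v hv m hm => by
    cases m with
    | zero => rfl
    | succ m => exact hv m (by omega)
  b_fil := fun n v hv m hm => by
    cases m with
    | zero => rfl
    | succ m =>
      change logInv N _ (v m) = 0
      rw [hv m (by omega), map_zero]

/-- `∑ P_ν(a) b^ν` acts on `Ξ_α^{(N)}` by `φ ↦ ∑ P_ν(s) (b^ν φ)`. -/
instance : Module Atilde (Xi α N) where
  smul x φ := act (ops α N) x φ
  one_smul φ := act_one (ops α N) φ
  mul_smul x y φ := act_assoc (ops α N) x y φ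
  smul_zero x := act_zero_right (ops α N) x
  smul_add x φ ψ := act_add_right (ops α N) x φ ψ
  add_smul x y φ := act_add_left (ops α N) x y φ
  zero_smul φ := act_zero_left (ops α N) φ

theorem smul_def (x : Atilde) (φ : Xi α N) : x • φ = act (ops α N) x φ := rfl

end Xi

/-- The left `Ã`-module `M` is an `[α]`-primitive theme: it is isomorphic to `Ã φ` for some
`φ ∈ Ξ_α^{(N)}` and some `N`. -/
def IsPrimitiveTheme (α : Set.Ioc (0 : ℚ) 1) (M : Type*) [AddCommGroup M] [Module Atilde M] :
    Prop :=
  ∃ (N : ℕ) (φ : Xi α N), Nonempty (M ≃ₗ[Atilde] Submodule.span Atilde {φ})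

/-- The rank of a left `Ã`-module: its rank as a module over `ℂ[[b]] ⊂ Ã`. -/
def rankB (M : Type*) [AddCommGroup M] [Module Atilde M] : ℕ :=
  letI : Module (PowerSeries ℂ) M := Module.compHom M ofPowerSeries
  Module.finrank (PowerSeries ℂ) M

/-- The left ideal `Ã (a - 2b)(a - b)`. -/
def idealT : Submodule Atilde Atilde :=
  Submodule.span Atilde {(a - (2 : ℂ) • b) * (a - b)}

/-- The left `Ã`-module `T = Ã / Ã (a - 2b)(a - b)`. -/
abbrev T : Type := Atilde ⧸ idealT

end ABModule

end

/-! The module `T` embeds in `Xi 1 1` by sending the class of `1` to `Log s`: `(a - b) Log s = b·1`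
and `(a - 2b) b·1 = 0`, while division by `(a - 2b)(a - b)` leaves a remainder `f + g (a - b)` with
`f, g ∈ ℂ[[b]]`, which kills `Log s` only if `f = g = 0`.

Everything is then computed in the `ℂ[[b]]`-basis `Log s, 1`. There `b` shifts both coordinates, and
modulo the span of `1` the operator `-b⁻¹a` multiplies `b^m Log s` by `-(m + 1)`. Hence a
homogeneous element of degree `k` with Bernstein polynomial `B` moves the log coefficient of index
`m` to index `m + k` and multiplies it by `(-1)^k B(-(m + 1))` (`Xi.logCoeff_bernsteinElement`).

Let `u_m` be the log coefficients of the image of `e`. Since `e` generates, `u_0 ≠ 0`. The relation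
`(P + cQ)e = 0` reads `c B_Q(-(m+1)) u_m = B_P(-(m+2)) u_{m+1}`, so `B_Q(-1), B_Q(-2) ≠ 0` force
`u_1, u_2 ≠ 0`, whatever `B_P` is. If `Re` had no logarithm, `B_R` would vanish at `-1, -2, -3`,
which is excluded.

Finally, an `Ã`-submodule of `Xi 1 1` in which a logarithm occurs has rank `2` (`rankB_eq_two`): a
suitable `a - (k+1)b` removes the logarithm from an element and leaves something nonzero. -/

namespace ABModule

open Atilde

/-! ### Coordinates on `Ξ_1^{(1)}` over `ℂ[[b]]` -/

namespace Xi

/-- The coefficient of `b^m (Log s)` of `φ ∈ Ξ_1^{(1)}` in the `ℂ[[b]]`-basis `Log s, 1`. -/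
noncomputable def logCoeff (φ : Xi 1 1) (m : ℕ) : ℂ := (m.factorial : ℂ) * φ m 1

/-- The coefficient of `b^m 1` of `φ ∈ Ξ_1^{(1)}` in the `ℂ[[b]]`-basis `Log s, 1`. -/
noncomputable def constCoeff (φ : Xi 1 1) (m : ℕ) : ℂ :=
  (m.factorial : ℂ) * (φ m 0 + ((harmonic m : ℚ) : ℂ) * φ m 1)

theorem add_apply (φ ψ : Xi 1 1) (m : ℕ) (j : Fin 2) : (φ + ψ) m j = φ m j + ψ m j := rfl

theorem complex_smul_apply (c : ℂ) (φ : Xi 1 1) (m : ℕ) (j : Fin 2) :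
    (c • φ) m j = c * φ m j := rfl

/-- `logCoeff` as a linear map. -/
noncomputable def logCoeffₗ (m : ℕ) : Xi 1 1 →ₗ[ℂ] ℂ where
  toFun φ := logCoeff φ m
  map_add' φ ψ := by simp only [logCoeff, add_apply]; ring
  map_smul' c φ := by simp only [logCoeff, complex_smul_apply, RingHom.id_apply, smul_eq_mul]; ring

/-- `constCoeff` as a linear map. -/
noncomputable def constCoeffₗ (m : ℕ) : Xi 1 1 →ₗ[ℂ] ℂ where
  toFun φ := constCoeff φ m
  map_add' φ ψ := by simp only [constCoeff, add_apply]; ring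
  map_smul' c φ := by
    simp only [constCoeff, complex_smul_apply, RingHom.id_apply, smul_eq_mul]; ring

instance : IsScalarTower ℂ Atilde (Xi 1 1) where
  smul_assoc c x φ := act_smul_left (ops 1 1) c x φ

/-! ### The operators `a` and `b` in coordinates -/

theorem a_smul (φ : Xi 1 1) : a • φ = mulS 1 φ := by
  have h : act (ops 1 1) (leftA oneSeries) φ = mulS 1 φ :=
    (act_leftA (ops 1 1) oneSeries φ).trans (congrArg (mulS 1) (act_one (ops 1 1) φ))
  refine Eq.trans ?_ h
  rw [smul_def, ← coeffs_one, ← coeffs_a_mul, mul_one]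
  rfl

theorem b_smul (φ : Xi 1 1) : b • φ = integ 1 1 φ := by
  have h : act (ops 1 1) (leftB oneSeries) φ = integ 1 1 φ :=
    (act_leftB (ops 1 1) oneSeries φ).trans (congrArg (integ 1 1) (act_one (ops 1 1) φ))
  refine Eq.trans ?_ h
  rw [smul_def, ← coeffs_one, ← coeffs_b_mul, mul_one]
  rfl

/-- Differentiating the primitive gives a triangular system in its two components, with diagonal
entry `α + m = m + 1`; solving it avoids expanding `logInv`. -/
theorem integ_succ_one (φ : Xi 1 1) (m : ℕ) : integ 1 1 φ (m + 1) 1 = φ m 1 / (m + 1) := by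
  have h := congrFun (deriv_integ 1 1 φ m) 1
  have h0 : (m : ℂ) + 1 ≠ 0 := Nat.cast_add_one_ne_zero m
  simp [derivLog] at h
  rw [eq_div_iff h0]
  linear_combination h

theorem integ_succ_zero (φ : Xi 1 1) (m : ℕ) :
    integ 1 1 φ (m + 1) 0 = φ m 0 / (m + 1) - φ m 1 / (m + 1) ^ 2 := by
  have h := congrFun (deriv_integ 1 1 φ m) 0
  have h1 := integ_succ_one φ m
  have h0 : (m : ℂ) + 1 ≠ 0 := Nat.cast_add_one_ne_zero m
  simp [derivLog] at h
  rw [h1] at h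
  field_simp at h ⊢
  linear_combination h

theorem logCoeff_b_zero (φ : Xi 1 1) : logCoeff (b • φ) 0 = 0 := by
  rw [b_smul]; exact mul_zero _

theorem constCoeff_b_zero (φ : Xi 1 1) : constCoeff (b • φ) 0 = 0 := by
  rw [b_smul]
  change _ * ((0 : ℂ) + _ * (0 : ℂ)) = 0
  simp

theorem logCoeff_a_zero (φ : Xi 1 1) : logCoeff (a • φ) 0 = 0 := by
  rw [a_smul]; exact mul_zero _

theorem constCoeff_a_zero (φ : Xi 1 1) : constCoeff (a • φ) 0 = 0 := by
  rw [a_smul]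
  change _ * ((0 : ℂ) + _ * (0 : ℂ)) = 0
  simp

theorem logCoeff_b_succ (φ : Xi 1 1) (m : ℕ) : logCoeff (b • φ) (m + 1) = logCoeff φ m := by
  have h0 : (m : ℂ) + 1 ≠ 0 := Nat.cast_add_one_ne_zero m
  rw [b_smul]
  refine (congrArg (_ * ·) (integ_succ_one φ m)).trans ?_
  rw [logCoeff, Nat.factorial_succ]
  push_cast
  field_simp

/-- This explains the harmonic number in `constCoeff`: `b^m Log s = (s^m / m!) (Log s - H_m)`, so
`s^m Log s` contributes `m! H_m` along `b^m 1`. With this correction `b` becomes a pure shift. -/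
theorem constCoeff_b_succ (φ : Xi 1 1) (m : ℕ) :
    constCoeff (b • φ) (m + 1) = constCoeff φ m := by
  have h0 : (m : ℂ) + 1 ≠ 0 := Nat.cast_add_one_ne_zero m
  rw [b_smul]
  refine (congrArg₂ (fun x y => _ * (x + _ * y)) (integ_succ_zero φ m)
    (integ_succ_one φ m)).trans ?_
  rw [constCoeff, Nat.factorial_succ, harmonic_succ]
  push_cast
  field_simp
  ring

theorem logCoeff_a_succ (φ : Xi 1 1) (m : ℕ) :
    logCoeff (a • φ) (m + 1) = (m + 1) * logCoeff φ m := by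
  rw [a_smul]
  change ((m + 1).factorial : ℂ) * φ m 1 = (m + 1) * ((m.factorial : ℂ) * φ m 1)
  rw [Nat.factorial_succ]
  push_cast
  ring

/-- The extra term comes from `H_{m+1} - H_m = 1/(m+1)`. It is the only coupling between the two
coordinates, and it makes the rank `2`. -/
theorem constCoeff_a_succ (φ : Xi 1 1) (m : ℕ) :
    constCoeff (a • φ) (m + 1) = (m + 1) * constCoeff φ m + logCoeff φ m := by
  have h0 : (m : ℂ) + 1 ≠ 0 := Nat.cast_add_one_ne_zero m
  rw [a_smul]
  change ((m + 1).factorial : ℂ) * (φ m 0 + ((harmonic (m + 1) : ℚ) : ℂ) * φ m 1) =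
    (m + 1) * ((m.factorial : ℂ) * (φ m 0 + ((harmonic m : ℚ) : ℂ) * φ m 1)) +
      (m.factorial : ℂ) * φ m 1
  rw [Nat.factorial_succ, harmonic_succ]
  push_cast
  field_simp
  ring

theorem ext_coeff {φ ψ : Xi 1 1} (h1 : ∀ m, logCoeff φ m = logCoeff ψ m)
    (h0 : ∀ m, constCoeff φ m = constCoeff ψ m) : φ = ψ := by
  funext m
  have hm : (m.factorial : ℂ) ≠ 0 := Nat.cast_ne_zero.2 m.factorial_ne_zero
  have e1 : φ m 1 = ψ m 1 := mul_left_cancel₀ hm (h1 m)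
  have e0 := mul_left_cancel₀ hm (h0 m)
  rw [e1] at e0
  funext j
  fin_cases j
  · exact add_right_cancel e0
  · exact e1

/-! ### Linearity of the coordinates over `ℂ[[b]]` -/

theorem ofPowerSeries_smul_apply (f : PowerSeries ℂ) (φ : Xi 1 1) (m : ℕ) :
    (ofPowerSeries f • φ) m =
      (∑ ν ∈ Finset.range (m + 1), PowerSeries.coeff ν f • (b ^ ν • φ) : Xi 1 1) m := by
  have hb : ∀ ν : ℕ, ((integ 1 1) ^ ν) φ = b ^ ν • φ := by
    intro ν
    induction ν with
    | zero => exact (one_smul Atilde φ).symm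
    | succ ν ih =>
      rw [pow_succ' b, mul_smul, ← ih, pow_succ']
      exact (b_smul _).symm
  have h : partialAct (ops 1 1) (m + 1) (fun n => C (PowerSeries.coeff n f)) φ =
      (∑ ν ∈ Finset.range (m + 1), PowerSeries.coeff ν f • (b ^ ν • φ) : Xi 1 1) := by
    refine Finset.sum_congr rfl fun ν _ => ?_
    rw [← hb]
    refine (congrFun (congrArg DFunLike.coe (aeval_C _ (PowerSeries.coeff ν f))) _).trans ?_
    rw [Algebra.algebraMap_eq_smul_one]
    rfl
  exact congrFun h m

/-- Stated for any coordinate on which `b` acts as a shift, so as to serve both `logCoeff` and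
`constCoeff`. -/
theorem coeff_b_pow_smul {F : Xi 1 1 → ℕ → ℂ} (h0 : ∀ φ, F (b • φ) 0 = 0)
    (hs : ∀ φ m, F (b • φ) (m + 1) = F φ m) (φ : Xi 1 1) (ν m : ℕ) :
    F (b ^ ν • φ) m = if ν ≤ m then F φ (m - ν) else 0 := by
  induction ν generalizing m with
  | zero => simp
  | succ ν ih =>
    rw [pow_succ', mul_smul]
    cases m with
    | zero => simp [h0]
    | succ m => rw [hs, ih]; simp

/-- The `ℂ[[b]]`-coordinate of `φ` along `Log s`. -/
noncomputable def logSeries (φ : Xi 1 1) : PowerSeries ℂ := PowerSeries.mk (logCoeff φ)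

/-- The `ℂ[[b]]`-coordinate of `φ` along `1`. -/
noncomputable def constSeries (φ : Xi 1 1) : PowerSeries ℂ := PowerSeries.mk (constCoeff φ)

theorem logSeries_smul (f : PowerSeries ℂ) (φ : Xi 1 1) :
    logSeries (ofPowerSeries f • φ) = f * logSeries φ := by
  ext m
  rw [logSeries, PowerSeries.coeff_mk, PowerSeries.coeff_mul,
    Finset.Nat.sum_antidiagonal_eq_sum_range_succ
      (fun i j => PowerSeries.coeff i f * PowerSeries.coeff j (logSeries φ)),
    logCoeff, ofPowerSeries_smul_apply]
  -- The coefficient of index `m` depends only on the term of index `m`, so the infinite series may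
  -- be replaced by a finite sum, to which linearity applies.
  change logCoeffₗ m (∑ ν ∈ Finset.range (m + 1), PowerSeries.coeff ν f • (b ^ ν • φ)) = _
  rw [map_sum]
  refine Finset.sum_congr rfl fun ν hν => ?_
  rw [map_smul, smul_eq_mul]
  change _ * logCoeff (b ^ ν • φ) m = _
  rw [coeff_b_pow_smul logCoeff_b_zero logCoeff_b_succ,
    if_pos (Nat.lt_succ_iff.1 (Finset.mem_range.1 hν)), logSeries, PowerSeries.coeff_mk]

theorem constSeries_smul (f : PowerSeries ℂ) (φ : Xi 1 1) :
    constSeries (ofPowerSeries f • φ) = f * constSeries φ := by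
  ext m
  rw [constSeries, PowerSeries.coeff_mk, PowerSeries.coeff_mul,
    Finset.Nat.sum_antidiagonal_eq_sum_range_succ
      (fun i j => PowerSeries.coeff i f * PowerSeries.coeff j (constSeries φ)),
    constCoeff, ofPowerSeries_smul_apply]
  change constCoeffₗ m (∑ ν ∈ Finset.range (m + 1), PowerSeries.coeff ν f • (b ^ ν • φ)) = _
  rw [map_sum]
  refine Finset.sum_congr rfl fun ν hν => ?_
  rw [map_smul, smul_eq_mul]
  change _ * constCoeff (b ^ ν • φ) m = _
  rw [coeff_b_pow_smul constCoeff_b_zero constCoeff_b_succ,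
    if_pos (Nat.lt_succ_iff.1 (Finset.mem_range.1 hν)), constSeries, PowerSeries.coeff_mk]

/-! ### Action of homogeneous elements -/

theorem logCoeff_a_sub_smul_b (c : ℂ) (φ : Xi 1 1) (m : ℕ) :
    logCoeff ((a - c • b) • φ) (m + 1) = (m + 1 - c) * logCoeff φ m := by
  change logCoeffₗ (m + 1) _ = _
  rw [sub_smul, smul_assoc, map_sub, LinearMap.map_smul]
  change logCoeff (a • φ) (m + 1) - c * logCoeff (b • φ) (m + 1) = _
  rw [logCoeff_a_succ, logCoeff_b_succ]
  ring

theorem constCoeff_a_sub_smul_b (c : ℂ) (φ : Xi 1 1) (m : ℕ) :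
    constCoeff ((a - c • b) • φ) (m + 1) = (m + 1 - c) * constCoeff φ m + logCoeff φ m := by
  change constCoeffₗ (m + 1) _ = _
  rw [sub_smul, smul_assoc, map_sub, LinearMap.map_smul]
  change constCoeff (a • φ) (m + 1) - c * constCoeff (b • φ) (m + 1) = _
  rw [constCoeff_a_succ, constCoeff_b_succ]
  ring

theorem logCoeff_a_sub_smul_b_zero (c : ℂ) (φ : Xi 1 1) :
    logCoeff ((a - c • b) • φ) 0 = 0 := by
  change logCoeffₗ 0 _ = _
  rw [sub_smul, smul_assoc, map_sub, LinearMap.map_smul]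
  change logCoeff (a • φ) 0 - c * logCoeff (b • φ) 0 = _
  rw [logCoeff_a_zero, logCoeff_b_zero]
  ring

theorem constCoeff_a_sub_smul_b_zero (c : ℂ) (φ : Xi 1 1) :
    constCoeff ((a - c • b) • φ) 0 = 0 := by
  change constCoeffₗ 0 _ = _
  rw [sub_smul, smul_assoc, map_sub, LinearMap.map_smul]
  change constCoeff (a • φ) 0 - c * constCoeff (b • φ) 0 = _
  rw [constCoeff_a_zero, constCoeff_b_zero]
  ring

/-- The factor `a - i b` acts at index `m + i`, where it multiplies by `(m + i + 1) - i = m + 1`: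
all factors contribute the same number. -/
theorem logCoeff_eulerProd (j : ℕ) (φ : Xi 1 1) (m : ℕ) :
    logCoeff (eulerProd j • φ) (m + j) = ((m : ℂ) + 1) ^ j * logCoeff φ m := by
  induction j with
  | zero => simp [eulerProd]
  | succ j ih =>
    rw [eulerProd, mul_smul, ← add_assoc, logCoeff_a_sub_smul_b, ih]
    push_cast
    ring

/-- On log coefficients `-b⁻¹a` is diagonal with eigenvalue `-(m + 1)` at index `m`, so `(-b)^k
B(-b⁻¹a)` evaluates `B` there and shifts by `k`. -/
theorem logCoeff_bernsteinElement (k : ℕ) (B : ℂ[X]) (hB : B.natDegree ≤ k) (φ : Xi 1 1) (m : ℕ) :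
    logCoeff (bernsteinElement k B • φ) (m + k) =
      (-1) ^ k * B.eval (-((m : ℂ) + 1)) * logCoeff φ m := by
  change logCoeffₗ (m + k) _ = _
  rw [bernsteinElement, Finset.sum_smul, map_sum,
    eval_eq_sum_range' (Nat.lt_succ_of_le hB), Finset.mul_sum, Finset.sum_mul]
  refine Finset.sum_congr rfl fun j hj => ?_
  obtain ⟨i, rfl⟩ := Nat.exists_eq_add_of_le' (Nat.lt_succ_iff.1 (Finset.mem_range.1 hj))
  rw [smul_assoc, LinearMap.map_smul, Nat.add_sub_cancel, mul_smul (b ^ i), smul_eq_mul]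
  change _ * logCoeff (b ^ i • eulerProd j • φ) _ = _
  rw [coeff_b_pow_smul logCoeff_b_zero logCoeff_b_succ, if_pos (by omega),
    show m + (i + j) - i = m + j by omega, logCoeff_eulerProd, neg_pow ((m : ℂ) + 1), pow_add]
  have : ((-1 : ℂ) ^ j) * (-1) ^ j = 1 := by rw [← mul_pow]; simp
  linear_combination (-(-1) ^ i * B.coeff j * ((m : ℂ) + 1) ^ j * logCoeff φ m) * this

/-- Both `a` and `b` raise the order in `s`, so only the scalar term of `x` reaches index `0`. -/
theorem smul_apply_zero (x : Atilde) (φ : Xi 1 1) : (x • φ) 0 = (coeffs x 0).eval 0 • φ 0 := by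
  rw [smul_def]
  refine (act_apply (ops 1 1) x φ 0).trans ?_
  rw [Finset.sum_range_one]
  change aeval (mulS 1) (coeffs x 0) φ 0 = _
  generalize coeffs x 0 = P
  induction P using Polynomial.induction_on' with
  | add p q hp hq =>
    rw [eval_add, add_smul, ← hp, ← hq, map_add]
    rfl
  | monomial k c =>
    rw [aeval_monomial, Algebra.algebraMap_eq_smul_one]
    cases k with
    | zero =>
      rw [eval_monomial, pow_zero, pow_zero, mul_one, mul_one]
      rfl
    | succ k =>
      rw [pow_succ', eval_monomial, zero_pow k.succ_ne_zero, mul_zero, zero_smul]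
      exact smul_zero c

end Xi
/-! ### Division by `(a - 2b)(a - b)` -/

namespace Atilde

/-- Multiplication by `b` on the left is onto the series without constant term. -/
theorem exists_eq_b_mul {x : Atilde} (hx : coeffs x 0 = 0) : ∃ y, x = b * y := by
  -- The witness solves the recurrence `leftB_succ` for `y n`, with `leftB y = x`.
  refine ⟨coeffs.symm fun n => coeffs x (n + 1) + derivative (coeffs x n), ?_⟩
  apply coeffs.injective
  rw [coeffs_b_mul, LinearEquiv.apply_symm_apply]
  funext n
  induction n with
  | zero => rw [hx, leftB_zero]
  | succ n ih => rw [leftB_succ, ← ih]; ring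

theorem coeffs_mul_zero (x y : Atilde) : coeffs (x * y) 0 = coeffs x 0 * coeffs y 0 := by
  rw [coeffs_mul, act_apply, Finset.sum_range_one]
  change aeval leftA _ (coeffs y) 0 = _
  rw [aeval_leftA]

theorem coeffs_b_pow_mul_of_lt (x : Atilde) {m n : ℕ} (h : m < n) : coeffs (b ^ n * x) m = 0 := by
  rw [coeffs_b_pow_mul x n m h.le, if_neg h.ne]

theorem eq_of_sub_eq_b_pow_mul {x y : Atilde} (h : ∀ n, ∃ z, x - y = b ^ n * z) : x = y := by
  apply coeffs.injective
  funext m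
  obtain ⟨z, hz⟩ := h (m + 1)
  have := congrArg (fun w => coeffs w m) hz
  simp only [coeffs_b_pow_mul_of_lt z (Nat.lt_succ_self m), map_sub] at this
  exact sub_eq_zero.1 this

/-- The sum of a `b`-adically convergent series. -/
theorem exists_b_adic_sum (z : ℕ → Atilde) :
    ∃ s : Atilde, ∀ n, ∃ w, s - ∑ i ∈ Finset.range n, b ^ i * z i = b ^ n * w := by
  have hfil : ∀ (n : ℕ) (x : Atilde), (∀ m < n, coeffs x m = 0) → ∃ w, x = b ^ n * w := by
    intro n
    induction n with
    | zero => exact fun x _ => ⟨x, by simp⟩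
    | succ n ih =>
      intro x hx
      obtain ⟨w, rfl⟩ := ih x fun m hm => hx m (by omega)
      have h0 := hx n (Nat.lt_succ_self n)
      rw [coeffs_b_pow_mul w n n le_rfl, if_pos rfl] at h0
      obtain ⟨y, rfl⟩ := exists_eq_b_mul h0
      exact ⟨y, by rw [pow_succ, mul_assoc]⟩
  -- Diagonal choice: the terms with `i > m` do not affect the coefficient of index `m`, which is
  -- therefore stable from the partial sum of `m + 1` terms on.
  refine ⟨coeffs.symm fun m => coeffs (∑ i ∈ Finset.range (m + 1), b ^ i * z i) m,
    fun n => hfil n _ fun m hm => ?_⟩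
  rw [map_sub, LinearEquiv.apply_symm_apply]
  change coeffs (∑ i ∈ Finset.range (m + 1), b ^ i * z i) m -
    coeffs (∑ i ∈ Finset.range n, b ^ i * z i) m = 0
  rw [← Finset.sum_range_add_sum_Ico _ (Nat.succ_le_of_lt hm), map_add, Pi.add_apply,
    sub_add_cancel_left, neg_eq_zero, map_sum, Finset.sum_apply]
  exact Finset.sum_eq_zero fun i hi => coeffs_b_pow_mul_of_lt _ (by
    have := (Finset.mem_Ico.1 hi).1; omega)

theorem smul_b_pow_eq (c : ℂ) (n : ℕ) :
    c • b ^ n = ofPowerSeries (PowerSeries.monomial n c) := by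
  have h := aeval_a_mul_b_pow (C c) n
  rw [aeval_C, ← Algebra.smul_def] at h
  rw [h]
  refine congrArg coeffs.symm ?_
  funext m
  rw [PowerSeries.coeff_monomial]
  split_ifs <;> simp

theorem ofPowerSeries_X : ofPowerSeries PowerSeries.X = b := by
  have := smul_b_pow_eq 1 1
  rw [one_smul, pow_one] at this
  exact this.symm

theorem exists_ofPowerSeries_sub (r : ℕ → ℂ) (n : ℕ) :
    ∃ w, ofPowerSeries (PowerSeries.mk r) - ∑ i ∈ Finset.range n, r i • b ^ i = b ^ n * w := by
  have h := PowerSeries.eq_X_pow_mul_shift_add_trunc n (PowerSeries.mk r)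
  refine ⟨ofPowerSeries (PowerSeries.mk fun i => PowerSeries.coeff (i + n) (PowerSeries.mk r)), ?_⟩
  refine sub_eq_iff_eq_add.2 ((congrArg ofPowerSeries h).trans ?_)
  rw [map_add, map_mul, map_pow, ofPowerSeries_X, PowerSeries.trunc_apply,
    Nat.Ico_zero_eq_range, ← Polynomial.coeToPowerSeries.ringHom_apply, map_sum, map_sum]
  congr 1
  refine Finset.sum_congr rfl fun i _ => ?_
  rw [Polynomial.coeToPowerSeries.ringHom_apply, Polynomial.coe_monomial, smul_b_pow_eq,
    PowerSeries.coeff_mk]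

/-- Weierstrass-type division: modulo `b` the divisor is `X ^ 2` and the remainders `1`, `a - b` are
`1`, `X`. Dividing the term of `b`-order `0` leaves an error `b * x'`; the process is repeated on
`x'` and the results are summed `b`-adically. -/
theorem exists_division (x : Atilde) : ∃ (y : Atilde) (f g : PowerSeries ℂ),
    x = y * ((a - (2 : ℂ) • b) * (a - b)) + ofPowerSeries f + ofPowerSeries g * (a - b) := by
  set p : Atilde := (a - (2 : ℂ) • b) * (a - b) with hp
  have ha : coeffs a 0 = X := rfl
  have hb : coeffs b 0 = 0 := rfl
  have hab : coeffs (a - b) 0 = X := by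
    rw [map_sub, Pi.sub_apply, ha, hb, sub_zero]
  have hp0 : coeffs p 0 = X ^ 2 := by
    rw [hp, coeffs_mul_zero, hab, map_sub, map_smul, Pi.sub_apply, Pi.smul_apply, ha, hb]
    simp [pow_two]
  -- One division step: the coefficient of `b^0` is divided by `X ^ 2`, and `r`, `s` are its two
  -- lowest coefficients.
  have step : ∀ x : Atilde, ∃ (q : ℂ[X]) (r s : ℂ) (x' : Atilde),
      x = aeval a q * p + r • 1 + s • (a - b) + b * x' := by
    intro x
    set P := coeffs x 0
    refine ⟨P.divX.divX, P.coeff 0, P.coeff 1, ?_⟩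
    have h := exists_eq_b_mul (x := x - (aeval a P.divX.divX * p + P.coeff 0 • (1 : Atilde) +
      P.coeff 1 • (a - b))) ?_
    · obtain ⟨y, hy⟩ := h
      exact ⟨y, by rw [← hy]; abel⟩
    · simp only [map_sub, map_add, map_smul, Pi.sub_apply, Pi.add_apply, Pi.smul_apply,
        coeffs_aeval_a_mul, hp0, ha, hb]
      have h1 := P.divX_mul_X_add
      have h2 := P.divX.divX_mul_X_add
      rw [coeff_divX, zero_add] at h2
      have h3 : coeffs 1 0 = 1 := rfl
      rw [h3, sub_eq_zero, smul_eq_C_mul, smul_eq_C_mul]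
      change P = _
      linear_combination -h1 - X * h2
  choose q r s x' h using step
  -- The powers of `b` accumulate on the left; the scalars `r`, `s` commute with them, so both
  -- remainder sums are truncations of series in `b`.
  have hn : ∀ n, x = (∑ i ∈ Finset.range n, b ^ i * aeval a (q (x'^[i] x))) * p +
      (∑ i ∈ Finset.range n, r (x'^[i] x) • b ^ i) +
      (∑ i ∈ Finset.range n, s (x'^[i] x) • b ^ i) * (a - b) + b ^ n * x'^[n] x := by
    intro n
    induction n with
    | zero => simp
    | succ n ih =>
      rw [Finset.sum_range_succ, Finset.sum_range_succ, Finset.sum_range_succ,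
        Function.iterate_succ_apply']
      have h' := congrArg (b ^ n * ·) (h (x'^[n] x))
      simp only [mul_add, mul_smul_comm, mul_one, ← mul_assoc, ← pow_succ] at h'
      refine ih.trans ?_
      rw [h', add_mul, add_mul, smul_mul_assoc]
      abel
  obtain ⟨y, hy⟩ := exists_b_adic_sum fun i => aeval a (q (x'^[i] x))
  refine ⟨y, PowerSeries.mk fun i => r (x'^[i] x), PowerSeries.mk fun i => s (x'^[i] x),
    eq_of_sub_eq_b_pow_mul fun n => ?_⟩
  obtain ⟨w1, h1⟩ := hy n
  obtain ⟨w2, h2⟩ := exists_ofPowerSeries_sub (fun i => r (x'^[i] x)) n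
  obtain ⟨w3, h3⟩ := exists_ofPowerSeries_sub (fun i => s (x'^[i] x)) n
  rw [sub_eq_iff_eq_add] at h1 h2 h3
  refine ⟨x'^[n] x - w1 * p - w2 - w3 * (a - b), ?_⟩
  refine (congrArg (· - _) (hn n)).trans ?_
  rw [h1, h2, h3]
  simp only [mul_sub (b ^ n), add_mul, mul_assoc]
  abel

end Atilde
/-! ### The embedding of `T` -/

namespace Xi

/-- The element `Log s` of `Ξ_1^{(1)}`. -/
noncomputable def logS : Xi 1 1 := fun m j => if m = 0 ∧ j = 1 then 1 else 0

theorem logCoeff_logS (m : ℕ) : logCoeff logS m = if m = 0 then 1 else 0 := by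
  cases m <;> simp [logCoeff, logS]

theorem constCoeff_logS (m : ℕ) : constCoeff logS m = 0 := by
  cases m <;> simp [constCoeff, logS]

theorem logSeries_logS : logSeries logS = 1 := by
  ext m
  rw [logSeries, PowerSeries.coeff_mk, logCoeff_logS, PowerSeries.coeff_one]

theorem constSeries_logS : constSeries logS = 0 := by
  ext m
  rw [constSeries, PowerSeries.coeff_mk, constCoeff_logS, map_zero]

theorem logCoeff_a_sub_b_logS (m : ℕ) : logCoeff ((a - b) • logS) m = 0 := by
  rw [← one_smul ℂ b]
  cases m with
  | zero => exact logCoeff_a_sub_smul_b_zero 1 _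
  | succ m => rw [logCoeff_a_sub_smul_b, logCoeff_logS]; split_ifs with h <;> simp [h]

theorem constCoeff_a_sub_b_logS (m : ℕ) :
    constCoeff ((a - b) • logS) m = if m = 1 then 1 else 0 := by
  rw [← one_smul ℂ b]
  cases m with
  | zero => exact constCoeff_a_sub_smul_b_zero 1 _
  | succ m => rw [constCoeff_a_sub_smul_b, logCoeff_logS, constCoeff_logS]; simp

theorem annihilates_logS : ((a - (2 : ℂ) • b) * (a - b)) • logS = 0 := by
  rw [mul_smul]
  refine ext_coeff (fun m => ?_) (fun m => ?_)
  · rw [show logCoeff 0 m = 0 from mul_zero _]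
    cases m with
    | zero => exact logCoeff_a_sub_smul_b_zero 2 _
    | succ m => rw [logCoeff_a_sub_smul_b, logCoeff_a_sub_b_logS, mul_zero]
  · rw [show constCoeff 0 m = 0 from map_zero (constCoeffₗ m)]
    cases m with
    | zero => exact constCoeff_a_sub_smul_b_zero 2 _
    | succ m =>
      rw [constCoeff_a_sub_smul_b, logCoeff_a_sub_b_logS, constCoeff_a_sub_b_logS, add_zero]
      split_ifs with h
      · rw [h]; norm_num
      · rw [mul_zero]

theorem logSeries_add (φ ψ : Xi 1 1) : logSeries (φ + ψ) = logSeries φ + logSeries ψ := by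
  ext m
  rw [map_add, logSeries, logSeries, logSeries, PowerSeries.coeff_mk, PowerSeries.coeff_mk,
    PowerSeries.coeff_mk]
  exact map_add (logCoeffₗ m) φ ψ

theorem constSeries_add (φ ψ : Xi 1 1) : constSeries (φ + ψ) = constSeries φ + constSeries ψ := by
  ext m
  rw [map_add, constSeries, constSeries, constSeries, PowerSeries.coeff_mk, PowerSeries.coeff_mk,
    PowerSeries.coeff_mk]
  exact map_add (constCoeffₗ m) φ ψ

theorem logSeries_zero : logSeries 0 = 0 := by
  ext m
  rw [logSeries, PowerSeries.coeff_mk]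
  exact map_zero (logCoeffₗ m)

theorem constSeries_zero : constSeries 0 = 0 := by
  ext m
  rw [constSeries, PowerSeries.coeff_mk]
  exact map_zero (constCoeffₗ m)

/-- After division, `x` sends `Log s` to the vector with coordinates `f` along `Log s` and `g * X`
along `1`, because `(a - b) Log s = b·1`. It vanishes only for `f = g = 0`. -/
theorem smul_logS_eq_zero_iff (x : Atilde) : x • logS = 0 ↔ x ∈ idealT := by
  constructor
  · intro hx
    obtain ⟨y, f, g, rfl⟩ := exists_division x
    rw [add_smul, add_smul, mul_smul y, annihilates_logS, smul_zero, zero_add,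
      mul_smul] at hx
    have hl : logSeries ((a - b) • logS) = 0 := by
      ext m; rw [logSeries, PowerSeries.coeff_mk, logCoeff_a_sub_b_logS, map_zero]
    have hc : constSeries ((a - b) • logS) = PowerSeries.X := by
      ext m
      rw [constSeries, PowerSeries.coeff_mk, constCoeff_a_sub_b_logS, PowerSeries.coeff_X]
    have h1 := congrArg logSeries hx
    rw [logSeries_add, logSeries_smul, logSeries_smul, hl, mul_zero, add_zero, logSeries_logS,
      mul_one, logSeries_zero] at h1
    have h2 := congrArg constSeries hx
    rw [constSeries_add, constSeries_smul, constSeries_smul, hc, constSeries_logS, mul_zero,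
      zero_add, constSeries_zero] at h2
    have h3 : g = 0 := (mul_eq_zero.1 h2).resolve_right PowerSeries.X_ne_zero
    rw [h1, h3, map_zero, zero_mul, add_zero, add_zero]
    exact Submodule.smul_mem _ _ (Submodule.mem_span_singleton_self _)
  · intro hx
    obtain ⟨y, rfl⟩ := Submodule.mem_span_singleton.1 hx
    rw [smul_eq_mul, mul_smul, annihilates_logS, smul_zero]

end Xi

/-- The embedding `T → Ξ_1^{(1)}` that sends the class of `1` to `Log s`. -/
noncomputable def embT : T →ₗ[Atilde] Xi 1 1 :=
  idealT.liftQ (LinearMap.toSpanSingleton Atilde (Xi 1 1) Xi.logS)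
    fun x hx => (Xi.smul_logS_eq_zero_iff x).2 hx

theorem embT_mk (x : Atilde) : embT (Submodule.Quotient.mk x) = x • Xi.logS := rfl

theorem embT_injective : Function.Injective embT := by
  refine (injective_iff_map_eq_zero embT).2 fun t ht => ?_
  obtain ⟨x, rfl⟩ := Submodule.Quotient.mk_surjective _ t
  rw [embT_mk, Xi.smul_logS_eq_zero_iff] at ht
  exact (Submodule.Quotient.mk_eq_zero _).2 ht

/-! ### Ranks -/

theorem rankB_congr {M M' : Type*} [AddCommGroup M] [Module Atilde M] [AddCommGroup M']
    [Module Atilde M'] (f : M ≃ₗ[Atilde] M') : rankB M = rankB M' := by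
  let _ : Module (PowerSeries ℂ) M := Module.compHom M ofPowerSeries
  let _ : Module (PowerSeries ℂ) M' := Module.compHom M' ofPowerSeries
  let g : M ≃ₗ[PowerSeries ℂ] M' :=
    { f.toAddEquiv with map_smul' := fun c x => f.map_smul (ofPowerSeries c) x }
  exact g.finrank_eq

/-- The two coordinates embed `N` in `ℂ[[b]]²`, which bounds the rank above. Stability under `a`
supplies a second element without logarithm, independent of `φ`. -/
theorem rankB_eq_two {N : Submodule Atilde (Xi 1 1)} {φ : Xi 1 1} (hφ : φ ∈ N)
    (h : Xi.logSeries φ ≠ 0) : rankB N = 2 := by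
  let _ : Module (PowerSeries ℂ) N := Module.compHom N ofPowerSeries
  let Φ : N →ₗ[PowerSeries ℂ] PowerSeries ℂ × PowerSeries ℂ :=
    { toFun := fun x => (Xi.logSeries x, Xi.constSeries x)
      map_add' := fun x y => Prod.ext (Xi.logSeries_add x y) (Xi.constSeries_add x y)
      map_smul' := fun f x => Prod.ext (Xi.logSeries_smul f x) (Xi.constSeries_smul f x) }
  have hΦ : Function.Injective Φ := by
    intro x y hxy
    have h1 := congrArg Prod.fst hxy
    have h2 := congrArg Prod.snd hxy
    refine Subtype.ext (Xi.ext_coeff (fun m => ?_) fun m => ?_)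
    · simpa [Φ, Xi.logSeries] using congrArg (PowerSeries.coeff m) h1
    · simpa [Φ, Xi.constSeries] using congrArg (PowerSeries.coeff m) h2
  -- Finiteness, from noetherianity of `ℂ[[b]]`, rules out the default value `0` of `finrank` in the
  -- lower bound.
  have : Module.Finite (PowerSeries ℂ) N := Module.Finite.of_injective Φ hΦ
  obtain ⟨ψ, hψN, hψl, hψc⟩ : ∃ ψ ∈ N, Xi.logSeries ψ = 0 ∧ Xi.constSeries ψ ≠ 0 := by
    obtain ⟨k, W, hU⟩ : ∃ (k : ℕ) (W : (PowerSeries ℂ)ˣ),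
        Xi.logSeries φ = PowerSeries.X ^ k * (W : PowerSeries ℂ) :=
      ⟨_, PowerSeries.Unit_of_divided_by_X_pow_order (Xi.logSeries φ), by
        rw [PowerSeries.Unit_of_divided_by_X_pow_order_nonzero h,
          PowerSeries.X_pow_order_mul_divXPowOrder]⟩
    -- Dividing by the unit part makes the log coordinate exactly `b^k`, with a single coefficient
    -- to be killed.
    set φ' := ofPowerSeries (↑W⁻¹ : PowerSeries ℂ) • φ
    have hφ' : φ' ∈ N := N.smul_mem _ hφ
    have hl : ∀ m, Xi.logCoeff φ' m = if m = k then 1 else 0 := by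
      have : Xi.logSeries φ' = PowerSeries.X ^ k := by
        rw [Xi.logSeries_smul, hU, mul_left_comm, Units.inv_mul, mul_one]
      intro m
      rw [← PowerSeries.coeff_X_pow, ← this, Xi.logSeries, PowerSeries.coeff_mk]
    -- The operator `a - (k + 1) b` annihilates the log coefficient of index `k`. At index `k + 1`
    -- of the constant coordinate the diagonal factor vanishes too, and the coupling term `1`
    -- remains.
    refine ⟨(a - ((k : ℂ) + 1) • b) • φ', N.smul_mem _ hφ', ?_, fun hc => ?_⟩
    · ext m
      rw [Xi.logSeries, PowerSeries.coeff_mk, map_zero]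
      cases m with
      | zero => exact Xi.logCoeff_a_sub_smul_b_zero _ _
      | succ m =>
        rw [Xi.logCoeff_a_sub_smul_b, hl]
        split_ifs with hm
        · rw [hm]; ring
        · rw [mul_zero]
    · have := congrArg (PowerSeries.coeff (k + 1)) hc
      rw [Xi.constSeries, PowerSeries.coeff_mk, Xi.constCoeff_a_sub_smul_b, hl, if_pos rfl] at this
      simp at this
  change Module.finrank (PowerSeries ℂ) N = 2
  refine le_antisymm ?_ ?_
  · have := LinearMap.finrank_le_finrank_of_injective hΦ
    simpa [Module.finrank_prod] using this
  · have hli : LinearIndependent (PowerSeries ℂ) ![(⟨φ, hφ⟩ : N), ⟨ψ, hψN⟩] := by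
      rw [LinearIndependent.pair_iff]
      intro f g hfg
      have h0 := congrArg Φ hfg
      rw [map_add, map_smul, map_smul, map_zero] at h0
      have h1 : f * Xi.logSeries φ + g * Xi.logSeries ψ = 0 := congrArg Prod.fst h0
      have h2 : f * Xi.constSeries φ + g * Xi.constSeries ψ = 0 := congrArg Prod.snd h0
      rw [hψl, mul_zero, add_zero] at h1
      have hf := (mul_eq_zero.1 h1).resolve_right h
      rw [hf, zero_mul, zero_add] at h2
      exact ⟨hf, (mul_eq_zero.1 h2).resolve_right hψc⟩
    simpa using hli.fintype_card_le_finrank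

/-- The submodule of `T` generated by `t` is a theme; it has rank `2` when a logarithm occurs in
the expansion of `t`. -/
theorem theme_span_singleton (t : T) :
    IsPrimitiveTheme 1 (Submodule.span Atilde {t}) ∧
      (Xi.logSeries (embT t) ≠ 0 → rankB (Submodule.span Atilde {t}) = 2) := by
  have E : Submodule.span Atilde {t} ≃ₗ[Atilde] Submodule.span Atilde {embT t} :=
    (Submodule.equivMapOfInjective embT embT_injective _).trans
      (LinearEquiv.ofEq _ _ (by rw [Submodule.map_span, Set.image_singleton]))
  exact ⟨⟨1, _, ⟨E⟩⟩, fun h => (rankB_congr E).trans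
    (rankB_eq_two (Submodule.mem_span_singleton_self _) h)⟩

/-! ### Logarithmic coefficients of a generator and the main theorem -/

theorem logSeries_ne_zero {φ : Xi 1 1} {m : ℕ} (h : Xi.logCoeff φ m ≠ 0) :
    Xi.logSeries φ ≠ 0 := fun h0 => h (by
  simpa [Xi.logSeries] using congrArg (PowerSeries.coeff m) h0)

/-- Some `x` carries the image of `e` to `Log s`. At index `0` the action of `x` is by a scalar, so
the nonzero log coefficient of `Log s` there must already be present in `e`. -/
theorem logCoeff_zero_ne_zero_of_generator {e : T} (he : Submodule.span Atilde {e} = ⊤) :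
    Xi.logCoeff (embT e) 0 ≠ 0 := by
  have h1 : (Submodule.Quotient.mk 1 : T) ∈ Submodule.span Atilde {e} := he ▸ Submodule.mem_top
  obtain ⟨x, hx⟩ := Submodule.mem_span_singleton.1 h1
  have h2 := congrArg embT hx
  rw [map_smul, embT_mk, one_smul] at h2
  intro h0
  have h3 : (x • embT e) 0 1 = 0 := by
    rw [Xi.smul_apply_zero, Pi.smul_apply, show embT e 0 1 = 0 by simpa [Xi.logCoeff] using h0,
      smul_zero]
  rw [h2] at h3
  exact one_ne_zero h3

end ABModule

theorem mainTheorem7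
    (e : ABModule.T) (he : Submodule.span ABModule.Atilde {e} = ⊤)
    (k : ℕ) (P Q R : ABModule.Atilde)
    (hP : ABModule.IsHomogeneousMonic 3 P)
    (hQ : ABModule.IsHomogeneousMonic 4 Q)
    (hR : ABModule.IsHomogeneousMonic k R)
    (c : ℂ) (hc : c ≠ 0) (hPQ : (P + c • Q) • e = 0)
    (BQ BR : ℂ[X])
    (hBQ : ABModule.IsBernsteinPoly 4 Q BQ)
    (hBR : ABModule.IsBernsteinPoly k R BR)
    (hQ1 : ¬ (X + C 1 : ℂ[X]) ∣ BQ) (hQ2 : ¬ (X + C 2 : ℂ[X]) ∣ BQ)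
    (hR123 : ¬ ((X + C 1) * (X + C 2) * (X + C 3) : ℂ[X]) ∣ BR) :
    (ABModule.rankB ABModule.T = 2 ∧ ABModule.IsPrimitiveTheme 1 ABModule.T) ∧
    ABModule.rankB (Submodule.span ABModule.Atilde {R • e}) = 2 ∧
      ABModule.IsPrimitiveTheme 1 (Submodule.span ABModule.Atilde {R • e}) := by
  open ABModule in
  have h0 := logCoeff_zero_ne_zero_of_generator he
  have eTop : T ≃ₗ[Atilde] Submodule.span Atilde {e} :=
    Submodule.topEquiv.symm.trans (LinearEquiv.ofEq _ _ he.symm)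
  obtain ⟨⟨N, φ, ⟨E⟩⟩, hr⟩ := theme_span_singleton e
  refine ⟨⟨(rankB_congr eTop).trans (hr (logSeries_ne_zero h0)), N, φ, ⟨eTop.trans E⟩⟩, ?_⟩
  suffices h : Xi.logSeries (embT (R • e)) ≠ 0 from
    ⟨(theme_span_singleton (R • e)).2 h, (theme_span_singleton (R • e)).1⟩
  obtain ⟨BP, ⟨hdP, rfl⟩, -⟩ := existsUnique_isBernsteinPoly 3 P hP
  obtain ⟨hdQ, rfl⟩ := hBQ
  obtain ⟨hdR, rfl⟩ := hBR
  rw [map_smul]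
  have hrel := congrArg embT hPQ
  rw [map_smul, map_zero] at hrel
  generalize embT e = u at *
  -- The log coefficient of index `m + 4` of the relation: `P`, of degree `3`, brings in index `m +
  -- 1` with sign `(-1)^3`, and `Q`, of degree `4`, index `m` with sign `(-1)^4`.
  have hrec : ∀ m : ℕ, -(BP.eval (-(((m : ℂ) + 1) + 1)) * Xi.logCoeff u (m + 1)) +
      c * (BQ.eval (-((m : ℂ) + 1)) * Xi.logCoeff u m) = 0 := by
    intro m
    have h1 := Xi.logCoeff_bernsteinElement 3 BP hdP u (m + 1)
    have h2 := Xi.logCoeff_bernsteinElement 4 BQ hdQ u m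
    have h3 := congrArg (Xi.logCoeffₗ (m + 4)) hrel
    rw [add_smul, smul_assoc, map_add, LinearMap.map_smul, map_zero] at h3
    change Xi.logCoeff _ (m + 4) + c * Xi.logCoeff _ (m + 4) = 0 at h3
    rw [h2, show m + 4 = m + 1 + 3 by ring, h1] at h3
    push_cast at h3
    linear_combination h3
  have dvd_iff : ∀ (z : ℂ) (B : ℂ[X]), (X + C z) ∣ B ↔ B.eval (-z) = 0 := by
    intro z B
    rw [← sub_neg_eq_add, ← C_neg, dvd_iff_isRoot, IsRoot.def]
  rw [dvd_iff] at hQ1 hQ2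
  -- If the next coefficient vanished, the term in `BP` would drop out whatever its value, leaving
  -- `c * BQ.eval (-1)` times a nonzero coefficient equal to zero. The same argument at `-2` gives
  -- `h2`.
  have h1 : Xi.logCoeff u 1 ≠ 0 := by
    intro hz
    have := hrec 0
    simp [hz, hc, h0, hQ1] at this
  have h2 : Xi.logCoeff u 2 ≠ 0 := by
    intro hz
    have := hrec 1
    norm_num [hz, hc, h1, hQ2] at this
  by_contra hz
  -- Without logarithm in the image of `R • e`, every index in the log support of `u` gives a root
  -- of `BR`; indices `0, 1, 2` give `-1, -2, -3`.
  have hall : ∀ m : ℕ, Xi.logCoeff u m ≠ 0 → BR.eval (-((m : ℂ) + 1)) = 0 := by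
    intro m hm
    by_contra hB
    have := Xi.logCoeff_bernsteinElement k BR hdR u m
    exact logSeries_ne_zero (m := m + k) (by
      rw [this]
      exact mul_ne_zero (mul_ne_zero (pow_ne_zero _ (by norm_num)) hB) hm) hz
  apply hR123
  have e1 : BR.eval (-1) = 0 := by simpa using hall 0 h0
  have e2 : BR.eval (-2) = 0 := by have := hall 1 h1; norm_num at this; exact this
  have e3 : BR.eval (-3) = 0 := by have := hall 2 h2; norm_num at this; exact this
  rw [← dvd_iff] at e1 e2 e3
  have cop : ∀ y z : ℂ, y ≠ z → IsCoprime (X + C y) (X + C z) := fun y z hyz => by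
    rw [← sub_neg_eq_add, ← sub_neg_eq_add, ← C_neg, ← C_neg]
    exact isCoprime_X_sub_C_of_isUnit_sub (isUnit_iff_ne_zero.2
      (sub_ne_zero.2 (neg_injective.ne hyz)))
  refine IsCoprime.mul_dvd (IsCoprime.mul_left (cop 1 3 ?_) (cop 2 3 ?_))
    (IsCoprime.mul_dvd (cop 1 2 ?_) e1 e2) e3 <;> norm_num
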